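/- Let $\mathscr G$ be an undirected weighted graph on $n$ vertices (loops allowed): a symmetric edge set $\mathscr E\subseteq\{1,\dots,n\}^2$ and a symmetric, entrywise non-negative weight matrix $W\in\mathbb R^{n\times n}$ vanishing outside $\mathscr E$. For a symmetric matrix $A$ put $L(A)=\mathrm{diag}(A\mathbb 1)-A$, where $\mathbb 1=(1,\dots,1)^T$, and denote the eigenvalues of $L(A)$ by $\lambda_1\le\dots\le\lambda_n$. Let $\langle A,B\rangle=\mathrm{trace}(A^TB)$ and let $\|\cdot\|_F$ be the Frobenius norm. Let $\mathcal S$ be the space of real $n\times n$ matrices vanishing outside $\mathscr E$, $\Pi_{\mathcal S}$ the orthogonal projection onto $\mathcal S$, and $\mathcal E_1=\{E\in\mathcal S: E=E^T,\ \|E\|_F=1\}$. Fix $\varepsilon>0$ and an integer $k$ with $2\le k\le n-1$. For symmetric $E$ let $F_\varepsilon(E)=\lambda_{k+1}(L(W+\varepsilon E))-\lambda_k(L(W+\varepsilon E))$, let $x,y$ be unit eigenvectors of $L(W+\varepsilon E)$ for $\lambda_{k+1}$ and $\lambda_k$ respectively, let $z$ be the vector with entries $z_i=x_i^2-y_i^2$,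 and $$R_\varepsilon(E)=\tfrac12\,(z\mathbb 1^T+\mathbb 1z^T)-xx^T+yy^T,$$ which is well defined when $\lambda_k$ and $\lambda_{k+1}$ are simple. Let $\mathcal M_4$ be the manifold of real $n\times n$ matrices of rank $4$ and, for $Y\in\mathcal M_4$, let $P_Y$ be the orthogonal projection (for $\langle\cdot,\cdot\rangle$) onto the tangent space of $\mathcal M_4$ at $Y$. Consider, on the symmetric matrices of $\mathcal M_4$, the equation $$\dot Y=-P_YR_\varepsilon(E)+\langle P_YR_\varepsilon(E),E\rangle\,Y,\qquad E=\Pi_{\mathcal S}Y.\tag{$*$}$$ **Theorem.** Let $Y_\star\in\mathcal M_4$ be symmetric and a stationary point of $(*)$ such that $E_\star=\Pi_{\mathcal S}Y_\star$ has $\|E_\star\|_F=1$, the eigenvalues $\lambda_k$ and $\lambda_{k+1}$ of $L(W+\varepsilon E_\star)$ are simple, and $P_{Y_\star}R_\varepsilon(E_\star)\ne0$. Suppose that $E_\star$ is a strong local minimum of $F_\varepsilon$ on $\mathcal E_1$, i.e. there are $\alpha,r>0$ with $F_\varepsilon(E)\ge F_\varepsilon(E_\star)+\alpha\|E-E_\star\|_F^2$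 for all $E\in\mathcal E_1$ with $\|E-E_\star\|_F<r$. Suppose further that, for some open neighbourhood $U$ of $Y_\star$ in $\mathbb R^{n\times n}$ (for instance $U=\mathbb R^{n\times n}$), $\Pi_{\mathcal S}$ restricts to a diffeomorphism of $\mathcal M_4\cap U$ onto its image. Then there are constants $\delta,C,c>0$ such that for every symmetric $Y_0\in\mathcal M_4$ with $\|\Pi_{\mathcal S}Y_0\|_F=1$ and $\|Y_0-Y_\star\|_F<\delta$, the equation $(*)$ has a solution on $[0,\infty)$ with $Y(0)=Y_0$, and every such solution satisfies 1. $\|Y(t)-Y_\star\|_F\le C e^{-ct}$ for all $t\ge0$; 2. $t\mapsto F_\varepsilon(\Pi_{\mathcal S}Y(t))$ is non-increasing on $[0,\infty)$; 3. $|F_\varepsilon(\Pi_{\mathcal S}Y(t))-F_\varepsilon(E_\star)|\le C e^{-ct}$ for all $t\ge0$. -/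

import Mathlib

open Set

noncomputable section

namespace LowRankFlow

/- Matrices carry the Frobenius norm throughout. -/
attribute [local instance] Matrix.frobeniusNormedAddCommGroup Matrix.frobeniusNormedSpace

/-- An undirected weighted graph on the vertices `0, …, n - 1`: a symmetric edge set (loops are
allowed) and a symmetric nonnegative weight matrix supported on the edges. -/
structure WeightedGraph (n : ℕ) where
  edges : Set (Fin n × Fin n)
  edges_symm : ∀ i j, (i, j) ∈ edges → (j, i) ∈ edges
  weight : Matrix (Fin n) (Fin n) ℝ
  weight_symm : weight.IsSymm
  weight_nonneg : ∀ i j, 0 ≤ weight i j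
  weight_eq_zero : ∀ i j, (i, j) ∉ edges → weight i j = 0

/-- The Frobenius inner product `⟨A, B⟩ = trace (Aᵀ B)`. -/
def frobInner {n : ℕ} (A B : Matrix (Fin n) (Fin n) ℝ) : ℝ := (A.transpose * B).trace

/-- The graph Laplacian `L(W) = diag(W 𝟙) - W`. -/
def laplacian {n : ℕ} (W : Matrix (Fin n) (Fin n) ℝ) : Matrix (Fin n) (Fin n) ℝ :=
  Matrix.diagonal (W.mulVec 1) - W

open scoped Classical in
/-- The `j`-th smallest eigenvalue `λ_j(A)`, `1 ≤ j ≤ n`, counted with multiplicity, of a real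
symmetric matrix. (Mathlib's `eigenvalues₀` is in decreasing order; the value is `0` when `A` is not
symmetric or `j` is out of range.) -/
def eigval {n : ℕ} (A : Matrix (Fin n) (Fin n) ℝ) (j : ℕ) : ℝ :=
  if h : A.IsHermitian ∧ 1 ≤ j ∧ j ≤ n then
    h.1.eigenvalues₀ ⟨n - j, by rw [Fintype.card_fin]; omega⟩
  else 0

/-- For a symmetric matrix and `1 ≤ j ≤ n` there is a unit eigenvector for `λ_j`. -/
theorem exists_unit_eigenvector {n : ℕ} {A : Matrix (Fin n) (Fin n) ℝ} (hA : A.IsHermitian)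
    {j : ℕ} (h1 : 1 ≤ j) (hn : j ≤ n) :
    ∃ v : Fin n → ℝ, v ⬝ᵥ v = 1 ∧ A.mulVec v = eigval A j • v := by
  have hlt : n - j < Fintype.card (Fin n) := by rw [Fintype.card_fin]; omega
  let e : Fin (Fintype.card (Fin n)) ≃ Fin n := Fintype.equivOfCardEq (Fintype.card_fin _)
  refine ⟨hA.eigenvectorBasis (e ⟨n - j, hlt⟩), ?_, ?_⟩
  · have h := hA.eigenvectorBasis.orthonormal.1 (e ⟨n - j, hlt⟩)
    rw [EuclideanSpace.norm_eq, Real.sqrt_eq_one] at h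
    rw [← h]
    simp [dotProduct, sq]
  · rw [hA.mulVec_eigenvectorBasis]
    congr 1
    simp only [eigval, hA, h1, hn, and_self, dif_pos, Matrix.IsHermitian.eigenvalues]
    congr 1
    exact e.symm_apply_apply _

open scoped Classical in
/-- A unit eigenvector `x_j(A)` for `λ_j(A)`; it is unique up to sign when `λ_j(A)` is simple. -/
def eigvec {n : ℕ} (A : Matrix (Fin n) (Fin n) ℝ) (j : ℕ) : Fin n → ℝ :=
  if h : ∃ v : Fin n → ℝ, v ⬝ᵥ v = 1 ∧ A.mulVec v = eigval A j • v then h.choose else 0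

/-- `λ_j(A)` is a simple eigenvalue of the (symmetric) matrix `A`. -/
def IsSimpleEigval {n : ℕ} (A : Matrix (Fin n) (Fin n) ℝ) (j : ℕ) : Prop :=
  Module.finrank ℝ (Module.End.eigenspace (Matrix.toLin' A) (eigval A j)) = 1

/-- The symmetric matrices of rank `4`, i.e. `M₄ ∩ Sym`. -/
def symRankFour (n : ℕ) : Set (Matrix (Fin n) (Fin n) ℝ) := {Y | Y.rank = 4 ∧ Y.IsSymm}

/-- The matrix of the orthogonal projection of `ℝⁿ` onto the range of `Y`. -/
def rangeProj {n : ℕ} (Y : Matrix (Fin n) (Fin n) ℝ) : Matrix (Fin n) (Fin n) ℝ :=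
  Matrix.toEuclideanLin.symm
    (LinearMap.range (Matrix.toEuclideanLin Y)).starProjection.toLinearMap

/-- The projection `P_Y A = A - (I - V₁V₁ᵀ) A (I - V₂V₂ᵀ)` onto the tangent space at `Y` of the
manifold of matrices of the same rank as `Y`, where `Y = V₁ΣV₂ᵀ` is a (reduced) singular value
decomposition, so that `V₁V₁ᵀ` and `V₂V₂ᵀ` are the orthogonal projections onto the ranges of `Y` and
`Yᵀ`. -/
def tangentProj {n : ℕ} (Y A : Matrix (Fin n) (Fin n) ℝ) : Matrix (Fin n) (Fin n) ℝ :=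
  A - (1 - rangeProj Y) * A * (1 - rangeProj Y.transpose)

theorem rangeProj_mul_self {n : ℕ} (Y : Matrix (Fin n) (Fin n) ℝ) : rangeProj Y * Y = Y := by
  apply Matrix.toEuclideanLin.injective
  ext1 v
  have h : Matrix.toEuclideanLin (rangeProj Y * Y) v
      = Matrix.toEuclideanLin (rangeProj Y) (Matrix.toEuclideanLin Y v) := by
    simp [Matrix.toLpLin_apply, Matrix.mulVec_mulVec]
  rw [h, rangeProj, LinearEquiv.apply_symm_apply]
  exact Submodule.starProjection_eq_self_iff.2 (LinearMap.mem_range_self _ v)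

theorem rangeProj_transpose {n : ℕ} (Y : Matrix (Fin n) (Fin n) ℝ) :
    (rangeProj Y).transpose = rangeProj Y := by
  have h : (rangeProj Y).IsHermitian := by
    rw [← Matrix.isSymmetric_toEuclideanLin_iff, rangeProj, LinearEquiv.apply_symm_apply]
    exact (LinearMap.range (Matrix.toEuclideanLin Y)).starProjection_isSymmetric
  simpa [Matrix.IsHermitian, Matrix.conjTranspose_eq_transpose_of_trivial] using h

theorem exists_rangeProj_eq_mul {n : ℕ} (Y : Matrix (Fin n) (Fin n) ℝ) :
    ∃ X, rangeProj Y = Y * X := by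
  have h : ∀ j, ∃ w : Fin n → ℝ, Y.mulVec w = (rangeProj Y).mulVec (Pi.single j 1) := by
    intro j
    have hm : Matrix.toEuclideanLin (rangeProj Y) (WithLp.toLp 2 (Pi.single j 1)) ∈
        LinearMap.range (Matrix.toEuclideanLin Y) := by
      rw [rangeProj, LinearEquiv.apply_symm_apply]
      exact Submodule.starProjection_apply_mem _ _
    obtain ⟨w, hw⟩ := hm
    refine ⟨w.ofLp, ?_⟩
    simpa [Matrix.toLpLin_apply] using hw
  choose w hw using h
  refine ⟨Matrix.of fun i j => w j i, ?_⟩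
  ext i j
  have := congrFun (hw j) i
  rw [Matrix.mulVec_single_one] at this
  exact this.symm

/-- `tangentProj Y A` lies in the tangent space `{Y B + C Y}` at `Y`. -/
theorem tangentProj_mem {n : ℕ} (Y A : Matrix (Fin n) (Fin n) ℝ) :
    ∃ B C, tangentProj Y A = Y * B + C * Y := by
  obtain ⟨X, hX⟩ := exists_rangeProj_eq_mul Y
  obtain ⟨Z, hZ⟩ := exists_rangeProj_eq_mul Y.transpose
  have hZ' : rangeProj Y.transpose = Z.transpose * Y := by
    rw [← rangeProj_transpose, hZ, Matrix.transpose_mul, Matrix.transpose_transpose]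
  refine ⟨X * A, (1 - rangeProj Y) * A * Z.transpose, ?_⟩
  rw [Matrix.mul_assoc _ Z.transpose, ← hZ', ← Matrix.mul_assoc Y, ← hX, tangentProj]
  noncomm_ring

/-- `A - tangentProj Y A` is orthogonal to the tangent space `{Y B + C Y}` at `Y`. -/
theorem frobInner_sub_tangentProj {n : ℕ} (Y A B C : Matrix (Fin n) (Fin n) ℝ) :
    frobInner (A - tangentProj Y A) (Y * B + C * Y) = 0 := by
  have h1 : (1 - rangeProj Y) * Y = 0 := by rw [sub_mul, one_mul, rangeProj_mul_self, sub_self]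
  have h2 : Y * (1 - rangeProj Y.transpose) = 0 := by
    have := congrArg Matrix.transpose (rangeProj_mul_self Y.transpose)
    rw [Matrix.transpose_mul, rangeProj_transpose, Matrix.transpose_transpose] at this
    rw [mul_sub, mul_one, this, sub_self]
  have h3 : (A - tangentProj Y A).transpose
      = (1 - rangeProj Y.transpose) * (A.transpose * (1 - rangeProj Y)) := by
    simp [tangentProj, Matrix.transpose_mul, rangeProj_transpose]
  rw [frobInner, h3, mul_add, Matrix.trace_add]
  have e1 : (1 - rangeProj Y.transpose) * (A.transpose * (1 - rangeProj Y)) * (Y * B) = 0 := by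
    rw [Matrix.mul_assoc, Matrix.mul_assoc, ← Matrix.mul_assoc _ Y, h1]; simp
  rw [e1, Matrix.trace_mul_comm, ← Matrix.mul_assoc, Matrix.mul_assoc C, h2]
  simp

/-- `f` is smooth on the subset `X`: near each point of `X` it extends to a smooth map defined on an
open set. -/
def SmoothOnSubset {V : Type*} [NormedAddCommGroup V] [NormedSpace ℝ V] (f : V → V) (X : Set V) :
    Prop :=
  ∀ x ∈ X, ∃ (O : Set V) (g : V → V), IsOpen O ∧ x ∈ O ∧ ContDiffOn ℝ (⊤ : ℕ∞) g O ∧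
    ∀ y ∈ X ∩ O, g y = f y

/-- `f` restricts to a diffeomorphism from `X` onto its image `f(X)`. -/
def IsDiffeoOntoImage {V : Type*} [NormedAddCommGroup V] [NormedSpace ℝ V] (f : V → V)
    (X : Set V) : Prop :=
  SmoothOnSubset f X ∧ ∃ g : V → V, SmoothOnSubset g (f '' X) ∧ LeftInvOn g f X

/-- `x` is a strong local minimum of `F` on `X`: the function grows at least quadratically around
`x` on `X`. -/
def IsStrongLocalMinOn {V : Type*} [NormedAddCommGroup V] (F : V → ℝ) (X : Set V) (x : V) : Prop :=
  x ∈ X ∧ ∃ α > 0, ∃ r > 0, ∀ y ∈ X, ‖y - x‖ < r → F x + α * ‖y - x‖ ^ 2 ≤ F y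

namespace WeightedGraph

variable {n : ℕ} (G : WeightedGraph n)

open scoped Classical in
/-- The orthogonal projection `Π_S` onto the matrices that vanish outside the edge set. -/
def patProj (A : Matrix (Fin n) (Fin n) ℝ) : Matrix (Fin n) (Fin n) ℝ :=
  Matrix.of fun i j => if (i, j) ∈ G.edges then A i j else 0

/-- The symmetric matrices of unit Frobenius norm that vanish outside the edge set. -/
def unitSphere : Set (Matrix (Fin n) (Fin n) ℝ) :=
  {E | E.IsSymm ∧ (∀ i j, (i, j) ∉ G.edges → E i j = 0) ∧ ‖E‖ = 1}

/-- `L(W + ε E)`. -/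
def lap (ε : ℝ) (E : Matrix (Fin n) (Fin n) ℝ) : Matrix (Fin n) (Fin n) ℝ :=
  laplacian (G.weight + ε • E)

/-- The functional `F_ε(E) = λ_{k+1}(L(W + ε E)) - λ_k(L(W + ε E))`. -/
def gap (k : ℕ) (ε : ℝ) (E : Matrix (Fin n) (Fin n) ℝ) : ℝ :=
  eigval (G.lap ε E) (k + 1) - eigval (G.lap ε E) k

/-- `R_ε(E) = (z 𝟙ᵀ + 𝟙 zᵀ) / 2 - x xᵀ + y yᵀ`, where `x`, `y` are unit eigenvectors of
`L(W + ε E)` for `λ_{k+1}`, `λ_k` and `z = x • x - y • y` (componentwise products). -/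
def R (k : ℕ) (ε : ℝ) (E : Matrix (Fin n) (Fin n) ℝ) : Matrix (Fin n) (Fin n) ℝ :=
  let x := eigvec (G.lap ε E) (k + 1)
  let y := eigvec (G.lap ε E) k
  let z := x * x - y * y
  (2⁻¹ : ℝ) • (Matrix.vecMulVec z 1 + Matrix.vecMulVec 1 z)
    - Matrix.vecMulVec x x + Matrix.vecMulVec y y

/-- The right-hand side `-P_Y R_ε(E) + ⟨P_Y R_ε(E), E⟩ Y`, `E = Π_S Y`, of the low-rank equation. -/
def lowRankField (k : ℕ) (ε : ℝ) (Y : Matrix (Fin n) (Fin n) ℝ) : Matrix (Fin n) (Fin n) ℝ :=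
  let E := G.patProj Y
  frobInner (tangentProj Y (G.R k ε E)) E • Y - tangentProj Y (G.R k ε E)

/-- `Y` is a solution on `[0, ∞)` of the low-rank equation in the symmetric rank-4 matrices. -/
def IsLowRankSolution (k : ℕ) (ε : ℝ) (Y : ℝ → Matrix (Fin n) (Fin n) ℝ) : Prop :=
  ∀ t, 0 ≤ t → Y t ∈ symRankFour n ∧
    HasDerivWithinAt Y (G.lowRankField k ε (Y t)) (Ici 0) t

end WeightedGraph

end LowRankFlow

end

attribute [local instance] Matrix.frobeniusNormedAddCommGroup Matrix.frobeniusNormedSpace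

open Filter Topology

/-! On symmetric directions `ε • R` is the gradient of the gap, and `R` is a sum of four rank-one
matrices. At a stationary point `P_Y R = μ Y` with `μ ≠ 0`, so comparing kernels and ranks gives `R
= μ Y⋆` itself (`eq_smul_of_tangentProj_eq`). Thus `E⋆` is critical on the sphere.

Near `Y⋆` the matrix `R(E)` has rank at most 4 and lies within `O(‖Y - Y⋆‖)` of `μ Y`. Its component
normal to the manifold at `Y` is therefore `O(‖Y - Y⋆‖²)` (`exists_normal_part_le`). The
diffeomorphism bounds `‖Y - Y⋆‖` by a multiple of `‖E - E⋆‖`. Hence `E = Π_S Y` follows the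
spherical gradient flow of the gap up to an error that is small relative to `‖E - E⋆‖`.

Quadratic growth makes the spherical gradient strongly monotone
(`eventually_gradient_monotone_of_quadratic_growth`). The flow of `E` therefore contracts
exponentially and lowers the gap (`perturbed_gradient_estimates`), and `Y` inherits the decay.
Differentiability of `R` comes from the C¹ dependence of simple spectral projections
(`eigval_differentiable_of_simple`).

For existence, the field is written as `C(Y) Y + Y C(Y)ᵀ` and truncated. Such flows never raise the
rank, and near `Y⋆` the rank exceeds 3, so it stays 4. The contraction estimate keeps the solution
where the truncation is inactive. -/

namespace LowRankFlow

/-! ### Strong monotonicity of spherical gradients and a priori flow estimates. -/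

section Abstract

variable {V : Type*} [NormedAddCommGroup V] [InnerProductSpace ℝ V]

/-- If `F` grows quadratically around `e` on the unit sphere of a subspace `S`, and `ε • R` is the
gradient of `F` in the directions of `S`, then the spherical gradient is strongly monotone at `e`. -/
theorem eventually_gradient_monotone_of_quadratic_growth (S : Submodule ℝ V) {F : V → ℝ}
    {F' : V → V →L[ℝ] ℝ} {R : V → V} {R' : V →L[ℝ] V} {e : V} {ε μ α r : ℝ} (hε : 0 < ε)
    (hα : 0 < α) (hr : 0 < r) (he : e ∈ S) (hnorm : ‖e‖ = 1)
    (hF : ∀ᶠ x in 𝓝 e, HasFDerivAt F (F' x) x)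
    (hF' : ∀ x, ∀ d ∈ S, F' x d = ε * inner ℝ (R x) d)
    (hR : HasFDerivAt R R' e) (hRe : ∀ d ∈ S, inner ℝ (R e) d = μ * inner ℝ e d)
    (hmin : ∀ x ∈ S, ‖x‖ = 1 → ‖x - e‖ < r → F e + α * ‖x - e‖ ^ 2 ≤ F x) :
    ∀ᶠ x in 𝓝 e, x ∈ S → ‖x‖ = 1 → α / ε * ‖x - e‖ ^ 2 ≤
      inner ℝ (R x) (x - e) - inner ℝ (R x) x * inner ℝ x (x - e) := by
  -- With `4η = α/ε`, growth will give `q ≥ 6η‖D‖²`. The linearization of `R` costs `η‖D‖²` and the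
  -- variation of the multiplier `η‖D‖²/2`, which leaves more than `4η‖D‖²`.
  set η : ℝ := α / ε / 4 with hη
  have hη0 : 0 < η := by positivity
  have h1 : ∀ᶠ x in 𝓝 e, ‖R x - R e - R' (x - e)‖ ≤ η * ‖x - e‖ :=
    (hasFDerivAt_iff_isLittleO.1 hR).def hη0
  have h2 : ∀ᶠ x in 𝓝 e, |inner ℝ (R x) x - μ| < η := by
    have hc : ContinuousAt (fun x => inner ℝ (R x) x - μ) e :=
      (hR.continuousAt.inner continuousAt_id).sub continuousAt_const
    have h0 : inner ℝ (R e) e - μ = 0 := by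
      rw [hRe e he, real_inner_self_eq_norm_sq, hnorm]; ring
    have := hc.tendsto
    rw [h0] at this
    simpa [Real.dist_eq] using this.eventually (Metric.ball_mem_nhds (0 : ℝ) hη0)
  obtain ⟨ρ, hρ, H⟩ := Metric.eventually_nhds_iff_ball.1 (hF.and (h1.and h2))
  filter_upwards [Metric.ball_mem_nhds e (lt_min hρ hr)] with x hx hxS hxn
  have hxρ : x ∈ Metric.ball e ρ := Metric.ball_subset_ball (min_le_left _ _) hx
  have hxr : ‖x - e‖ < r := by
    rw [← dist_eq_norm]; exact lt_of_lt_of_le hx (min_le_right _ _)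
  set D := x - e with hD
  have hDS : D ∈ S := S.sub_mem hxS he
  have hseg : ∀ s ∈ Icc (0 : ℝ) 1, e + s • D ∈ Metric.ball e ρ := by
    intro s hs
    rw [mem_ball_iff_norm, add_sub_cancel_left, norm_smul, Real.norm_eq_abs, abs_of_nonneg hs.1]
    rw [mem_ball_iff_norm, ← hD] at hxρ
    nlinarith [hs.2, norm_nonneg D]
  have hRlin : ∀ s ∈ Icc (0 : ℝ) 1, ‖R (e + s • D) - R e - s • R' D‖ ≤ η * ‖D‖ := by
    intro s hs
    have := (H _ (hseg s hs)).2.1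
    rw [add_sub_cancel_left, map_smul, norm_smul, Real.norm_eq_abs, abs_of_nonneg hs.1] at this
    refine this.trans ?_
    have : s * ‖D‖ ≤ ‖D‖ := mul_le_of_le_one_left (norm_nonneg D) hs.2
    gcongr
  set q : ℝ := inner ℝ (R' D - μ • D) D with hq
  -- The Lagrangian `F - (εμ/2)‖·‖²` along the chord, minus its quadratic model: its derivative is
  -- just the linearization error of `R`. The norm term cancels between the endpoints because both
  -- lie on the sphere. No second derivative of `F` away from `e` is needed.
  have hder : ∀ s ∈ Icc (0 : ℝ) 1, HasDerivWithinAt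
      (fun s : ℝ => F (e + s • D) - ε * μ / 2 * ‖e + s • D‖ ^ 2 - ε * q / 2 * s ^ 2)
      (ε * inner ℝ (R (e + s • D) - R e - s • R' D) D) (Icc 0 1) s := by
    intro s hs
    have hline : HasDerivAt (fun s : ℝ => e + s • D) D s := by
      simpa using ((hasDerivAt_id s).smul_const D).const_add e
    have hFs := (H _ (hseg s hs)).1.comp_hasDerivAt s hline
    have hNs := (hline.norm_sq).const_mul (ε * μ / 2)
    have hQs := ((hasDerivAt_id s).pow 2).const_mul (ε * q / 2)
    refine (((hFs.sub hNs).sub hQs).congr_deriv ?_).hasDerivWithinAt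
    rw [hF' _ D hDS]
    have e1 : inner ℝ (R e) D = μ * inner ℝ e D := hRe D hDS
    simp only [hq, inner_sub_left, inner_add_left, real_inner_smul_left, e1, id]
    push_cast
    ring
  have hb := norm_image_sub_le_of_norm_deriv_le_segment_01' hder (C := ε * (η * ‖D‖ * ‖D‖)) (by
    intro s hs
    rw [norm_mul, Real.norm_of_nonneg hε.le]
    have := (norm_inner_le_norm (𝕜 := ℝ) (R (e + s • D) - R e - s • R' D) D).trans
      (mul_le_mul_of_nonneg_right (hRlin s (Ico_subset_Icc_self hs)) (norm_nonneg D))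
    gcongr)
  have hx1 : e + (1 : ℝ) • D = x := by simp [hD]
  have hx0 : e + (0 : ℝ) • D = e := by simp
  rw [hx1, hx0, hxn, hnorm, Real.norm_eq_abs] at hb
  have hb' := (abs_le.1 hb).2
  have hm := hmin x hxS hxn hxr
  have hR1 := hRlin 1 (right_mem_Icc.2 zero_le_one)
  rw [hx1, one_smul] at hR1
  have hin := (abs_le.1 ((abs_real_inner_le_norm (R x - R e - R' D) D).trans
      (mul_le_mul_of_nonneg_right hR1 (norm_nonneg D)))).1
  -- A chord of the unit sphere is orthogonal to its endpoints up to `‖D‖²/2`, with opposite signs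
  -- at the two ends.
  have hxD : inner ℝ x D = ‖D‖ ^ 2 / 2 := by
    have h3 : ‖e‖ ^ 2 = ‖x - D‖ ^ 2 := by rw [hD, sub_sub_cancel]
    rw [norm_sub_sq_real, hxn, hnorm] at h3
    linarith
  have heD : inner ℝ e D = -(‖D‖ ^ 2 / 2) := by
    have h3 : e = x - D := by rw [hD, sub_sub_cancel]
    rw [h3, inner_sub_left, hxD, real_inner_self_eq_norm_sq]; ring
  have h2x := (abs_lt.1 (H x hxρ).2.2).2
  have hqq : q = inner ℝ (R' D) D - μ * ‖D‖ ^ 2 := by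
    rw [hq, inner_sub_left, real_inner_smul_left, real_inner_self_eq_norm_sq]
  rw [inner_sub_left, inner_sub_left, hRe D hDS, heD] at hin
  rw [hxD]
  have hαη : α = 4 * ε * η := by rw [hη]; field_simp
  have hq2 : 6 * η * ‖D‖ ^ 2 ≤ q := by
    have : ε * (6 * η * ‖D‖ ^ 2) ≤ ε * q := by rw [hαη] at hm; nlinarith
    exact le_of_mul_le_mul_left this hε
  have h5 : inner ℝ (R x) x * (‖D‖ ^ 2 / 2) ≤ (μ + η) * (‖D‖ ^ 2 / 2) := by
    gcongr; linarith
  have : α / ε = 4 * η := by rw [hη]; ring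
  rw [this]
  nlinarith [mul_nonneg hη0.le (sq_nonneg ‖D‖)]

/-- Continuous induction on `[0, ∞)`: a bound that improves itself holds forever. -/
theorem forall_lt_of_bootstrap {φ : ℝ → ℝ} {ρ : ℝ} (hφ : ContinuousOn φ (Ici 0))
    (h : ∀ T, 0 ≤ T → (∀ t ∈ Ico 0 T, φ t < ρ) → φ T < ρ) : ∀ t, 0 ≤ t → φ t < ρ := by
  intro t ht
  by_contra! hcon
  have hK : IsCompact ({s ∈ Icc 0 t | ρ ≤ φ s}) := by
    have hc : ContinuousOn φ (Icc 0 t) := hφ.mono Icc_subset_Ici_self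
    exact isCompact_Icc.of_isClosed_subset
      (hc.preimage_isClosed_of_isClosed isClosed_Icc isClosed_Ici) (fun _ hs => hs.1)
  obtain ⟨T, hT, hmin⟩ := hK.exists_isLeast ⟨t, ⟨ht, le_rfl⟩, hcon⟩
  refine absurd (h T hT.1.1 fun s hs => ?_) (not_lt.2 hT.2)
  by_contra! hs'
  exact absurd (hmin ⟨⟨hs.1, hs.2.le.trans hT.1.2⟩, hs'⟩) (not_le.2 hs.2)

/-- A priori estimate for a flow `Y' = v(Y)` whose image `P Y` under a linear map stays on the unit
sphere and is attracted by `P y`, as long as `Y` stays in the ball of radius `ρ` around `y`. -/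
theorem flow_estimate {P : V →L[ℝ] V} {A : Set V} {v : V → V} {y : V} {ρ L c K : ℝ}
    (hL : 0 ≤ L) (hc : 0 < c)
    (h1 : ∀ x ∈ A, ‖x - y‖ < ρ → |inner ℝ (P (v x)) (P x)| ≤ K * |‖P x‖ ^ 2 - 1|)
    (h2 : ∀ x ∈ A, ‖x - y‖ < ρ → ‖P x‖ = 1 → ‖x - y‖ ≤ L * ‖P x - P y‖)
    (h3 : ∀ x ∈ A, ‖x - y‖ < ρ → ‖P x‖ = 1 →
      inner ℝ (P (v x)) (P x - P y) ≤ -c * ‖P x - P y‖ ^ 2)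
    {Y : ℝ → V} (hY : ContinuousOn Y (Ici 0))
    (hYd : ∀ t, 0 ≤ t → ‖Y t - y‖ < ρ → Y t ∈ A ∧ HasDerivWithinAt Y (v (Y t)) (Ici 0) t)
    (h0 : ‖P (Y 0)‖ = 1) (h0ρ : ‖Y 0 - y‖ < ρ) (h0P : L * ‖P (Y 0) - P y‖ < ρ) :
    ∀ t, 0 ≤ t → ‖Y t - y‖ < ρ ∧ ‖P (Y t)‖ = 1 ∧
      ‖P (Y t) - P y‖ ≤ ‖P (Y 0) - P y‖ * Real.exp (-c * t) := by
  have hPc : ContinuousOn (fun t => P (Y t)) (Ici 0) := P.continuous.comp_continuousOn hY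
  have key : ∀ T, 0 ≤ T → (∀ t ∈ Ico 0 T, ‖Y t - y‖ < ρ) → ∀ t ∈ Icc 0 T,
      ‖P (Y t)‖ = 1 ∧ ‖P (Y t) - P y‖ ≤ ‖P (Y 0) - P y‖ * Real.exp (-c * t) := by
    intro T hT hlt
    have hsub : Icc 0 T ⊆ Ici (0 : ℝ) := Icc_subset_Ici_self
    have hder : ∀ t ∈ Ico 0 T, HasDerivWithinAt (fun t => P (Y t)) (P (v (Y t))) (Ici t) t :=
      fun t ht => P.hasFDerivAt.comp_hasDerivWithinAt t
        ((hYd t ht.1 (hlt t ht)).2.mono (Ici_subset_Ici.2 ht.1))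
    -- The sphere must be shown invariant first, since `h2` and `h3` are available only on it. The
    -- defect `g = ‖P Y‖² - 1` satisfies `|g'| ≤ 2K|g|` and vanishes at time 0.
    have hn : ∀ t ∈ Icc 0 T, ‖P (Y t)‖ ^ 2 - 1 = 0 := by
      refine eq_zero_of_abs_deriv_le_mul_abs_self_of_eq_zero_right (K := 2 * K)
        (f' := fun t => 2 * inner ℝ (P (Y t)) (P (v (Y t))))
        (((hPc.mono hsub).norm.pow 2).sub continuousOn_const)
        (fun t ht => ((hder t ht).norm_sq).sub_const 1) (by rw [h0]; norm_num) ?_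
      intro t ht
      rw [norm_mul, Real.norm_ofNat, real_inner_comm, Real.norm_eq_abs, Real.norm_eq_abs, mul_assoc]
      exact mul_le_mul_of_nonneg_left (h1 _ (hYd t ht.1 (hlt t ht)).1 (hlt t ht)) zero_le_two
    have hn1 : ∀ t ∈ Icc 0 T, ‖P (Y t)‖ = 1 := fun t ht => by
      have := sub_eq_zero.1 (hn t ht)
      exact (pow_eq_one_iff_of_nonneg (norm_nonneg _) two_ne_zero).1 this
    intro t ht
    refine ⟨hn1 t ht, ?_⟩
    have hg : ‖P (Y t) - P y‖ ^ 2 ≤ gronwallBound (‖P (Y 0) - P y‖ ^ 2) (-2 * c) 0 (t - 0) := by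
      refine le_gronwallBound_of_liminf_deriv_right_le
        (f' := fun t => 2 * inner ℝ (P (Y t) - P y) (P (v (Y t))))
        (f := fun t => ‖P (Y t) - P y‖ ^ 2)
        (((hPc.mono hsub).sub continuousOn_const).norm.pow 2) ?_ le_rfl ?_ t ht
      · intro t ht r hr
        exact (((hder t ht).sub_const (P y)).norm_sq).liminf_right_slope_le hr
      · intro t ht
        have := h3 _ (hYd t ht.1 (hlt t ht)).1 (hlt t ht) (hn1 t (Ico_subset_Icc_self ht))
        rw [real_inner_comm]
        linarith
    rw [gronwallBound_ε0, sub_zero] at hg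
    refine le_of_sq_le_sq ?_ (by positivity)
    calc _ ≤ _ := hg
      _ = _ := by rw [mul_pow, ← Real.exp_nat_mul]; congr 2; push_cast; ring
  have hall : ∀ t, 0 ≤ t → ‖Y t - y‖ < ρ := by
    refine forall_lt_of_bootstrap (hY.sub continuousOn_const).norm fun T hT hlt => ?_
    rcases hT.eq_or_lt with rfl | hT0
    · exact h0ρ
    -- This bound is uniform in `t` and strictly below `ρ`, so it survives passage to the closure
    -- and improves the assumption at `T`.
    have hle : ∀ t ∈ Ico 0 T, ‖Y t - y‖ ≤ L * ‖P (Y 0) - P y‖ := by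
      intro t ht
      obtain ⟨hk1, hk2⟩ := key T hT hlt t (Ico_subset_Icc_self ht)
      refine (h2 _ (hYd t ht.1 (hlt t ht)).1 (hlt t ht) hk1).trans ?_
      refine mul_le_mul_of_nonneg_left (hk2.trans (mul_le_of_le_one_right (norm_nonneg _) ?_)) hL
      rw [Real.exp_le_one_iff]
      nlinarith [ht.1]
    have hcl : ContinuousOn (fun t => ‖Y t - y‖) (closure (Ico 0 T)) := by
      rw [closure_Ico hT0.ne]
      exact ((hY.mono Icc_subset_Ici_self).sub continuousOn_const).norm
    refine lt_of_le_of_lt (le_on_closure hle hcl continuousOn_const ?_) h0P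
    rw [closure_Ico hT0.ne]
    exact right_mem_Icc.2 hT
  intro t ht
  exact ⟨hall t ht, key t ht (fun s hs => hall s hs.1) t (right_mem_Icc.2 ht)⟩

end Abstract

/-! ### Global integral curves. -/

/-- A bounded Lipschitz vector field on a Banach space has forward-complete integral curves. -/
theorem exists_global_solution {E : Type*} [NormedAddCommGroup E] [NormedSpace ℝ E]
    [CompleteSpace E] {f : E → E} {K : NNReal} (hf : LipschitzWith K f) {B : ℝ}
    (hB : ∀ x, ‖f x‖ ≤ B) (x₀ : E) :
    ∃ Y : ℝ → E, Y 0 = x₀ ∧ ∀ t, 0 ≤ t → HasDerivWithinAt Y (f (Y t)) (Ici 0) t := by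
  have hB0 : 0 ≤ B := (norm_nonneg _).trans (hB x₀)
  lift B to NNReal using hB0
  have hloc : ∀ N : ℕ, ∃ Y : ℝ → E, Y 0 = x₀ ∧
      ∀ t ∈ Icc (0 : ℝ) N, HasDerivWithinAt Y (f (Y t)) (Icc (0 : ℝ) N) t := by
    intro N
    have h0 : (0 : ℝ) ∈ Icc (0 : ℝ) N := ⟨le_rfl, N.cast_nonneg⟩
    -- At speed at most `B` a curve travels at most `B * N` in time `N`. Choosing this as the ball
    -- radius makes Picard–Lindelöf work on all of `[0, N]`.
    have hp : IsPicardLindelof (fun _ => f) (⟨0, h0⟩ : Icc (0 : ℝ) N) x₀ (B * N) 0 B K :=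
      IsPicardLindelof.of_time_independent (fun x _ => hB x) hf.lipschitzOnWith (by simp)
    exact hp.exists_eq_forall_mem_Icc_hasDerivWithinAt₀
  choose Z hZ0 hZ using hloc
  have huniq : ∀ N M : ℕ, N ≤ M → EqOn (Z N) (Z M) (Icc 0 N) := by
    intro N M hNM
    have hNM' : (N : ℝ) ≤ M := by exact_mod_cast hNM
    have hsub : Icc (0 : ℝ) N ⊆ Icc 0 M := Icc_subset_Icc_right hNM'
    have haux : ∀ (k : ℕ), (N : ℝ) ≤ k → ∀ t ∈ Ico (0 : ℝ) N,
        HasDerivWithinAt (Z k) (f (Z k t)) (Ici t) t := by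
      intro k hk t ht
      refine (hZ k t ⟨ht.1, ht.2.le.trans hk⟩).mono_of_mem_nhdsWithin ?_
      exact mem_of_superset (Icc_mem_nhdsGE (ht.2.trans_le hk)) (Icc_subset_Icc_left ht.1)
    exact ODE_solution_unique (v := fun _ => f) (fun _ => hf)
      (fun t ht => (hZ N t ht).continuousWithinAt) (haux N le_rfl)
      (fun t ht => ((hZ M t (hsub ht)).mono hsub).continuousWithinAt) (haux M hNM')
      ((hZ0 N).trans (hZ0 M).symm)
  have hval : ∀ (N : ℕ) (t : ℝ), 0 ≤ t → t < N → Z (⌊t⌋₊ + 1) t = Z N t := by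
    intro N t ht htN
    refine huniq _ _ ?_ ⟨ht, ?_⟩
    · exact Nat.floor_lt ht |>.2 htN
    · exact_mod_cast (Nat.lt_floor_add_one t).le
  -- The index `⌊t⌋₊ + 1` exceeds `t` strictly, so near `t` the glued curve agrees with one fixed
  -- local solution.
  refine ⟨fun t => Z (⌊t⌋₊ + 1) t, by simpa using hZ0 _, fun t ht => ?_⟩
  set N := ⌊t⌋₊ + 1 with hN
  have htN : t < N := by rw [hN]; exact_mod_cast Nat.lt_floor_add_one t
  have hd : HasDerivWithinAt (Z N) (f (Z N t)) (Ici 0) t := by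
    refine (hZ N t ⟨ht, htN.le⟩).mono_of_mem_nhdsWithin ?_
    rw [← Ici_inter_Iic]
    exact inter_mem_nhdsWithin _ (Iic_mem_nhds htN)
  refine hd.congr_of_eventuallyEq ?_ rfl
  filter_upwards [inter_mem_nhdsWithin (Ici 0) (Iio_mem_nhds htN)] with s hs
  exact hval N s hs.1 hs.2

/-- Real square matrices of size `n`. -/
abbrev SqMat (n : ℕ) := Matrix (Fin n) (Fin n) ℝ

/-! ### Matrix calculus, rank invariance and smooth range projections. -/

section MatrixAnalysis

variable {n : ℕ}

theorem frobInner_eq_sum (A B : SqMat n) : frobInner A B = ∑ i, ∑ j, A i j * B i j := by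
  rw [frobInner, Matrix.trace, Finset.sum_comm]
  simp [Matrix.mul_apply]

theorem frobInner_self (A : SqMat n) : frobInner A A = ‖A‖ ^ 2 := by
  rw [frobInner_eq_sum, Matrix.frobenius_norm_def, ← Real.sqrt_eq_rpow, Real.sq_sqrt (by positivity)]
  simp [sq]

/-- The Frobenius inner product, inducing the Frobenius norm. -/
@[reducible]
noncomputable def frobeniusInnerProductSpace (n : ℕ) : InnerProductSpace ℝ (SqMat n) :=
  { Matrix.frobeniusNormedSpace with
    inner := frobInner
    norm_sq_eq_re_inner := fun A => (frobInner_self A).symm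
    conj_inner_symm := fun A B => by
      simp only [frobInner_eq_sum, mul_comm, conj_trivial]
    add_left := fun A B C => by
      simp [frobInner_eq_sum, add_mul, Finset.sum_add_distrib]
    smul_left := fun A B r => by
      simp [frobInner_eq_sum, mul_assoc, Finset.mul_sum] }

/-- Submultiplicativity of the Frobenius norm makes the square matrices a normed algebra, where
multiplication is smooth. -/
theorem contDiffAt_matrix_mul {E : Type*} [NormedAddCommGroup E] [NormedSpace ℝ E]
    {f g : E → SqMat n} {x : E} {m : WithTop ℕ∞} (hf : ContDiffAt ℝ m f x)
    (hg : ContDiffAt ℝ m g x) : ContDiffAt ℝ m (fun y => f y * g y) x := by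
  let _ : NormedRing (SqMat n) := Matrix.frobeniusNormedRing
  let _ : NormedAlgebra ℝ (SqMat n) := Matrix.frobeniusNormedAlgebra
  exact ContDiffAt.mul (𝔸 := SqMat n) hf hg

theorem contDiffAt_matrix_inv {A : SqMat n} {m : WithTop ℕ∞} (hA : IsUnit A) :
    ContDiffAt ℝ m (fun B : SqMat n => B⁻¹) A := by
  let _ : NormedRing (SqMat n) := Matrix.frobeniusNormedRing
  let _ : NormedAlgebra ℝ (SqMat n) := Matrix.frobeniusNormedAlgebra
  have h : (fun B : SqMat n => B⁻¹) = Ring.inverse := funext Matrix.nonsing_inv_eq_ringInverse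
  rw [h]
  obtain ⟨u, rfl⟩ := hA
  exact contDiffAt_ringInverse ℝ u

theorem eventually_isUnit_matrix {A : SqMat n} (hA : IsUnit A) : ∀ᶠ B in 𝓝 A, IsUnit B := by
  let _ : NormedRing (SqMat n) := Matrix.frobeniusNormedRing
  exact Units.isOpen.mem_nhds hA

theorem contDiff_linearMap {E F : Type*} [NormedAddCommGroup E] [NormedSpace ℝ E]
    [FiniteDimensional ℝ E] [NormedAddCommGroup F] [NormedSpace ℝ F] {m : WithTop ℕ∞}
    (f : E →ₗ[ℝ] F) : ContDiff ℝ m f :=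
  (LinearMap.toContinuousLinearMap f).contDiff

/-- The set of matrices of rank at most `r` is closed. -/
theorem isClosed_rank_le (r : ℕ) : IsClosed {A : SqMat n | A.rank ≤ r} := by
  have h := (isOpen_setOfPred_nat_le_rank (𝕜 := ℝ) (E := Fin n → ℝ) (F := Fin n → ℝ)
    (r + 1)).isClosed_compl
  have hc : Continuous fun A : SqMat n => LinearMap.toContinuousLinearMap (Matrix.toLin' A) :=
    LinearMap.continuous_of_finiteDimensional
      ((LinearMap.toContinuousLinearMap :
        ((Fin n → ℝ) →ₗ[ℝ] (Fin n → ℝ)) ≃ₗ[ℝ] _).toLinearMap ∘ₗ (Matrix.toLin').toLinearMap)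
  convert h.preimage hc using 1
  ext A
  simp only [mem_preimage, mem_compl_iff, mem_ofPred_eq, not_le, LinearMap.coe_toContinuousLinearMap]
  rw [LinearMap.rank, ← Module.finrank_eq_rank]
  change Module.finrank ℝ (LinearMap.range A.mulVecLin) ≤ r ↔ _
  rw [Nat.cast_lt, Nat.lt_succ_iff]
  rfl

/-- A flow of the form `Y' = C Y + Y Cᵀ` does not increase the rank. -/
theorem rank_le_of_hasDerivWithinAt {r : ℕ} {Y C : ℝ → SqMat n} {K : ℝ}
    (hC : ∀ t, 0 ≤ t → ‖C t‖ ≤ K)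
    (hY : ∀ t, 0 ≤ t → HasDerivWithinAt Y (C t * Y t + Y t * (C t).transpose) (Ici 0) t)
    (h0 : (Y 0).rank ≤ r) : ∀ t, 0 ≤ t → (Y t).rank ≤ r := by
  set S : Set (SqMat n) := {A | A.rank ≤ r} with hS
  have hcl : IsClosed S := isClosed_rank_le r
  have hne : S.Nonempty := ⟨Y 0, h0⟩
  have hYc : ContinuousOn Y (Ici 0) := fun t ht => (hY t ht).continuousWithinAt
  intro T hT
  suffices h : Metric.infDist (Y T) S ≤ 0 by
    exact (hcl.mem_iff_infDist_zero hne).2 (le_antisymm h Metric.infDist_nonneg)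
  -- Grönwall for the distance to the closed set of matrices of rank at most `r`, which grows at
  -- rate at most `2K` times itself and starts at 0.
  have hg := le_gronwallBound_of_liminf_deriv_right_le (f := fun t => Metric.infDist (Y t) S)
    (f' := fun t => 2 * K * Metric.infDist (Y t) S) (δ := 0) (K := 2 * K) (ε := 0) (a := 0) (b := T)
    ((Metric.continuous_infDist_pt S).comp_continuousOn (hYc.mono Icc_subset_Ici_self)) ?_
    (Metric.infDist_zero_of_mem (s := S) h0).le (fun t _ => by simp) T (right_mem_Icc.2 hT)
  · simpa [gronwallBound_ε0_δ0] using hg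
  intro t ht b hb
  obtain ⟨N, hN, hd⟩ := hcl.exists_infDist_eq_dist hne (Y t)
  set D := C t with hDdef
  -- Comparison with the curve `(1 + (z-t)D) N (1 + (z-t)Dᵀ)` through a nearest point `N`. It never
  -- leaves the low-rank set, and to first order it moves by the same linear field as `Y`.
  let G : ℝ → SqMat n := fun z => Y z -
    (N + (z - t) • (D * N + N * D.transpose) + (z - t) ^ 2 • (D * N * D.transpose))
  have hG : HasDerivWithinAt G (D * (Y t - N) + (Y t - N) * D.transpose) (Ici t) t := by
    have h1 : HasDerivAt (fun z : ℝ => z - t) 1 t := (hasDerivAt_id t).sub_const t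
    have h2 := ((h1.smul_const (D * N + N * D.transpose)).const_add N).add
      ((h1.pow 2).smul_const (D * N * D.transpose))
    refine (((hY t ht.1).mono (Ici_subset_Ici.2 ht.1)).sub h2.hasDerivWithinAt).congr_deriv ?_
    simp only [sub_self]
    simp
    noncomm_ring
  have hGt : ‖G t‖ = Metric.infDist (Y t) S := by
    rw [hd, dist_eq_norm]; simp [G]
  have hle : ∀ z, Metric.infDist (Y z) S ≤ ‖G z‖ := by
    intro z
    have hmem : N + (z - t) • (D * N + N * D.transpose) + (z - t) ^ 2 • (D * N * D.transpose) ∈ S := by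
      have : N + (z - t) • (D * N + N * D.transpose) + (z - t) ^ 2 • (D * N * D.transpose)
          = (1 + (z - t) • D) * N * (1 + (z - t) • D.transpose) := by
        simp only [add_mul, mul_add, one_mul, mul_one, smul_mul_assoc, mul_smul_comm, smul_add,
          smul_smul, sq]
        abel
      rw [this]
      exact (Matrix.rank_mul_le_left _ _).trans ((Matrix.rank_mul_le_right _ _).trans hN)
    exact (Metric.infDist_le_dist_of_mem hmem).trans_eq (dist_eq_norm _ _)
  have hnorm : ‖D * (Y t - N) + (Y t - N) * D.transpose‖ < b := by
    refine lt_of_le_of_lt ?_ hb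
    have hDK : ‖D‖ ≤ K := hC t ht.1
    have e1 := Matrix.frobenius_norm_mul D (Y t - N)
    have e2 := Matrix.frobenius_norm_mul (Y t - N) D.transpose
    rw [Matrix.frobenius_norm_transpose] at e2
    have e3 : ‖D‖ * ‖Y t - N‖ ≤ K * ‖Y t - N‖ := by gcongr
    rw [hd, dist_eq_norm]
    refine (norm_add_le _ _).trans ?_
    linarith
  refine (hG.liminf_right_slope_norm_le hnorm).mp ?_
  filter_upwards [self_mem_nhdsWithin] with z hz hlt
  refine lt_of_le_of_lt ?_ hlt
  rw [hGt]
  have : 0 ≤ (z - t)⁻¹ := inv_nonneg.2 (sub_nonneg.2 (mem_Ioi.1 hz).le)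
  gcongr
  exact hle z

/-- A symmetric matrix that fixes `Y` and factors through `Y` is the projection onto the range. -/
theorem eq_rangeProj {Y P X : SqMat n} (hs : P.transpose = P) (h1 : P * Y = Y) (h2 : P = Y * X) :
    P = rangeProj Y := by
  obtain ⟨X', hX'⟩ := exists_rangeProj_eq_mul Y
  have e1 : rangeProj Y * P = P := by
    rw [h2, ← Matrix.mul_assoc, rangeProj_mul_self]
  have e2 : P * rangeProj Y = rangeProj Y := by
    rw [hX', ← Matrix.mul_assoc, h1]
  have := congrArg Matrix.transpose e1
  rw [Matrix.transpose_mul, rangeProj_transpose, hs, e2] at this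
  exact this.symm

theorem isUnit_of_mulVec_injective {A : SqMat n} (h : ∀ v, A.mulVec v = 0 → v = 0) : IsUnit A := by
  rw [Matrix.isUnit_iff_isUnit_det, isUnit_iff_ne_zero]
  intro h0
  obtain ⟨v, hv, hv0⟩ := Matrix.exists_mulVec_eq_zero_iff.2 h0
  exact hv (h v hv0)

theorem mul_rangeProj_of_isSymm {Y : SqMat n} (hs : Y.IsSymm) : Y * rangeProj Y = Y := by
  have := congrArg Matrix.transpose (rangeProj_mul_self Y)
  rwa [Matrix.transpose_mul, rangeProj_transpose, hs.eq] at this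

theorem rangeProj_mul_rangeProj (Y : SqMat n) : rangeProj Y * rangeProj Y = rangeProj Y := by
  obtain ⟨X, hX⟩ := exists_rangeProj_eq_mul Y
  conv_lhs => rw [hX, ← Matrix.mul_assoc, ← hX, rangeProj_mul_self]
  exact hX.symm

theorem exists_eq_mul_of_range_le {A B : SqMat n}
    (h : LinearMap.range A.mulVecLin ≤ LinearMap.range B.mulVecLin) : ∃ Z, A = B * Z := by
  have h' : ∀ j, ∃ w : Fin n → ℝ, B.mulVec w = A.mulVec (Pi.single j 1) := fun j =>
    h ⟨Pi.single j 1, rfl⟩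
  choose w hw using h'
  refine ⟨Matrix.of fun i j => w j i, ?_⟩
  ext i j
  have := congrFun (hw j) i
  rw [Matrix.mulVec_single_one] at this
  exact this.symm

theorem matrix_rank_add_le (A B : SqMat n) : (A + B).rank ≤ A.rank + B.rank := by
  have h : LinearMap.range (A + B).mulVecLin ≤
      LinearMap.range A.mulVecLin ⊔ LinearMap.range B.mulVecLin := by
    rintro _ ⟨v, rfl⟩
    rw [Matrix.mulVecLin_add, LinearMap.add_apply]
    exact Submodule.add_mem_sup ⟨v, rfl⟩ ⟨v, rfl⟩
  exact (Submodule.finrank_mono h).trans (Submodule.finrank_add_le_finrank_add_finrank _ _)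

/-- Near a symmetric matrix of rank `r`, the range projection of symmetric matrices of rank `r` is
the restriction of a smooth map of the form `Y ↦ Y X(Y)`. -/
theorem exists_contDiffAt_rangeProj {r : ℕ} {Y₀ : SqMat n} (hs : Y₀.IsSymm) (hr : Y₀.rank = r) :
    ∃ X : SqMat n → SqMat n, ContDiffAt ℝ 1 X Y₀ ∧
      ∀ᶠ Y in 𝓝 Y₀, Y.IsSymm → Y.rank ≤ r → Y * X Y = rangeProj Y := by
  set P := rangeProj Y₀ with hP
  have hPs : P.transpose = P := rangeProj_transpose Y₀
  have hPP : P * P = P := rangeProj_mul_rangeProj Y₀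
  have hPY : P * Y₀ = Y₀ := rangeProj_mul_self Y₀
  have hYP : Y₀ * P = Y₀ := mul_rangeProj_of_isSymm hs
  obtain ⟨X₀, hX₀⟩ := exists_rangeProj_eq_mul Y₀
  have hPX : P = X₀.transpose * Y₀ := by
    rw [← hPs, hP, hX₀, Matrix.transpose_mul, hs.eq]
  -- With `W = Y P`, this is `WᵀW` completed by the identity on the complement of the range of `Y₀`.
  -- Then `W N⁻¹ Wᵀ` is the least-squares formula for the projection onto the range of `W`, and it
  -- depends smoothly on `Y`.
  let N : SqMat n → SqMat n := fun Y => P * Y * (Y * P) + (1 - P)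
  have hPc : ContDiffAt ℝ 1 (fun _ : SqMat n => P) Y₀ := contDiffAt_const
  have hN : ContDiffAt ℝ 1 N Y₀ :=
    (contDiffAt_matrix_mul (contDiffAt_matrix_mul hPc contDiffAt_id)
      (contDiffAt_matrix_mul contDiffAt_id hPc)).add contDiffAt_const
  have hN₀ : IsUnit (N Y₀) := by
    have e : N Y₀ = Y₀ * Y₀ + (1 - P) := by simp only [N, hPY, hYP]
    rw [e]
    refine isUnit_of_mulVec_injective fun v hv => ?_
    have h1 : Y₀.mulVec (Y₀.mulVec v) = 0 := by
      have := congrArg P.mulVec hv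
      rw [Matrix.mulVec_mulVec, Matrix.mulVec_zero, mul_add, ← Matrix.mul_assoc, hPY, mul_sub, hPP,
        mul_one, sub_self, add_zero] at this
      rwa [Matrix.mulVec_mulVec]
    have h2 : Y₀.mulVec v = 0 := by
      have h3 : Y₀.mulVec v ⬝ᵥ Y₀.mulVec v = 0 := by
        rw [Matrix.dotProduct_mulVec, ← Matrix.mulVec_transpose, hs.eq, h1, zero_dotProduct]
      exact dotProduct_self_eq_zero.1 h3
    have h3 : P.mulVec v = 0 := by
      rw [hPX, ← Matrix.mulVec_mulVec, h2, Matrix.mulVec_zero]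
    rwa [Matrix.add_mulVec, ← Matrix.mulVec_mulVec, h1, zero_add, Matrix.sub_mulVec,
      Matrix.one_mulVec, h3, sub_zero] at hv
  refine ⟨fun Y => P * (N Y)⁻¹ * (P * Y), ?_, ?_⟩
  · exact contDiffAt_matrix_mul
      (contDiffAt_matrix_mul hPc ((contDiffAt_matrix_inv hN₀).comp Y₀ hN))
      (contDiffAt_matrix_mul hPc contDiffAt_id)
  filter_upwards [hN.continuousAt.eventually (eventually_isUnit_matrix hN₀)] with Y hU hYs hYr
  have hdet : IsUnit (N Y).det := (Matrix.isUnit_iff_isUnit_det _).1 hU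
  have hNs : (N Y).transpose = N Y := by
    simp only [N, Matrix.transpose_add, Matrix.transpose_mul, Matrix.transpose_sub, hPs, hYs.eq,
      Matrix.transpose_one]
  have hNQ : N Y * (1 - P) = 1 - P := by
    have : P * (1 - P) = 0 := by rw [mul_sub, mul_one, hPP, sub_self]
    simp only [N, add_mul, Matrix.mul_assoc, this, mul_zero, zero_add]
    rw [mul_sub, mul_one, sub_mul, one_mul, hPP, sub_self, sub_zero]
  have hNiQ : (N Y)⁻¹ * (1 - P) = 1 - P := by
    conv_lhs => rw [← hNQ]
    rw [Matrix.nonsing_inv_mul_cancel_left _ _ hdet]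
  have hfix : Y * P * (N Y)⁻¹ * (P * Y) * (Y * P) = Y * P := by
    have e : P * Y * (Y * P) = N Y - (1 - P) := by simp [N]
    rw [Matrix.mul_assoc _ (P * Y), e, mul_sub, Matrix.nonsing_inv_mul_cancel_right _ _ hdet,
      Matrix.mul_assoc _ (N Y)⁻¹, hNiQ, Matrix.mul_assoc, mul_sub, mul_one, hPP, sub_self, mul_zero,
      sub_zero]
  -- Invertibility of `N Y` forces `W` to have rank at least `r`. Since `Y` has rank at most `r`,
  -- `W` and `Y` have the same range.
  have hrank : r ≤ (Y * P).rank := by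
    have h1 : n ≤ (P * Y * (Y * P)).rank + (1 - P).rank := by
      have := Matrix.rank_of_isUnit _ hU
      rw [Fintype.card_fin] at this
      exact this.symm.le.trans (matrix_rank_add_le _ _)
    have h2 : (P * Y * (Y * P)).rank ≤ (Y * P).rank := Matrix.rank_mul_le_right _ _
    have h3 : Y₀.rank + (1 - P).rank ≤ n := by
      have := Matrix.rank_add_rank_le_card_of_mul_eq_zero (A := Y₀) (B := 1 - P)
        (by rw [mul_sub, mul_one, hYP, sub_self])
      rwa [Fintype.card_fin] at this
    omega
  have hle : LinearMap.range (Y * P).mulVecLin ≤ LinearMap.range Y.mulVecLin := by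
    rintro _ ⟨v, rfl⟩
    exact ⟨P.mulVec v, by simp⟩
  have heq := Submodule.eq_of_le_of_finrank_le hle (hYr.trans hrank)
  obtain ⟨Z, hZ⟩ := exists_eq_mul_of_range_le heq.ge
  have e : Y * (P * (N Y)⁻¹ * (P * Y)) = Y * P * (N Y)⁻¹ * (P * Y) := by
    simp only [Matrix.mul_assoc]
  refine eq_rangeProj (X := P * (N Y)⁻¹ * (P * Y)) ?_ ?_ rfl
  · simp only [Matrix.transpose_mul, Matrix.transpose_nonsing_inv, hNs, hYs.eq, hPs, Matrix.mul_assoc]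
  · rw [e]
    conv_lhs => rw [hZ]
    conv_rhs => rw [hZ]
    rw [← Matrix.mul_assoc]
    simp only [hfix, ← hZ]

end MatrixAnalysis

/-! ### Weyl's inequality. -/

/-- Expansion of the quadratic form of a symmetric operator in an eigenbasis. -/
theorem inner_apply_self_eq_sum {E : Type*} [NormedAddCommGroup E] [InnerProductSpace ℝ E]
    [FiniteDimensional ℝ E] {T : E →ₗ[ℝ] E} (hT : T.IsSymmetric) {N : ℕ}
    (hN : Module.finrank ℝ E = N) (v : E) :
    inner ℝ (T v) v = ∑ k, hT.eigenvalues hN k * inner ℝ (hT.eigenvectorBasis hN k) v ^ 2 := by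
  rw [← (hT.eigenvectorBasis hN).sum_inner_mul_inner (T v) v]
  refine Finset.sum_congr rfl fun k _ => ?_
  rw [hT v, hT.apply_eigenvectorBasis, inner_smul_right, real_inner_comm]
  simp only [RCLike.ofReal_real_eq_id, id]
  ring

/-- Weyl's inequality: the ordered eigenvalues are monotone in the quadratic form. -/
theorem eigenvalues_le_add_of_inner_le {E : Type*} [NormedAddCommGroup E] [InnerProductSpace ℝ E]
    [FiniteDimensional ℝ E] {T T' : E →ₗ[ℝ] E} (hT : T.IsSymmetric) (hT' : T'.IsSymmetric) {N : ℕ}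
    (hN : Module.finrank ℝ E = N) {c : ℝ}
    (h : ∀ v, inner ℝ (T v) v ≤ inner ℝ (T' v) v + c * ‖v‖ ^ 2) (i : Fin N) :
    hT.eigenvalues hN i ≤ hT'.eigenvalues hN i + c := by
  set b := hT.eigenvectorBasis hN with hb
  set b' := hT'.eigenvectorBasis hN with hb'
  -- The eigenvalues here are in decreasing order. Only `N - 1` conditions are imposed, so some
  -- nonzero `v` lies both in the span of the top eigenvectors of `T` (up to index `i`) and in that
  -- of the bottom ones of `T'` (from index `i`).
  let φ : E →ₗ[ℝ] ({k : Fin N // k ≠ i} → ℝ) := LinearMap.pi fun k =>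
    if i < k.1 then (innerSL ℝ (b k.1)).toLinearMap else (innerSL ℝ (b' k.1)).toLinearMap
  have hker : LinearMap.ker φ ≠ ⊥ := by
    apply LinearMap.ker_ne_bot_of_finrank_lt
    rw [hN, Module.finrank_fintype_fun_eq_card, Fintype.card_subtype_compl]
    have := i.pos
    simp; omega
  obtain ⟨v, hv, hv0⟩ := Submodule.exists_mem_ne_zero_of_ne_bot hker
  have hφ : ∀ k : {k : Fin N // k ≠ i}, φ v k = 0 := fun k => congrFun (LinearMap.mem_ker.1 hv) k
  have h1 : ∀ k, i < k → inner ℝ (b k) v = 0 := by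
    intro k hk
    have := hφ ⟨k, hk.ne'⟩
    simpa [φ, hk] using this
  have h2 : ∀ k, k < i → inner ℝ (b' k) v = 0 := by
    intro k hk
    have := hφ ⟨k, hk.ne⟩
    simpa [φ, hk.not_gt] using this
  have e1 : hT.eigenvalues hN i * ‖v‖ ^ 2 ≤ inner ℝ (T v) v := by
    rw [inner_apply_self_eq_sum hT hN, ← b.sum_sq_inner_right v, Finset.mul_sum]
    refine Finset.sum_le_sum fun k _ => ?_
    rcases le_or_gt k i with hk | hk
    · exact mul_le_mul_of_nonneg_right (hT.eigenvalues_antitone hN hk) (sq_nonneg _)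
    · rw [← hb, h1 k hk]; simp
  have e2 : inner ℝ (T' v) v ≤ hT'.eigenvalues hN i * ‖v‖ ^ 2 := by
    rw [inner_apply_self_eq_sum hT' hN, ← b'.sum_sq_inner_right v, Finset.mul_sum]
    refine Finset.sum_le_sum fun k _ => ?_
    rcases le_or_gt i k with hk | hk
    · exact mul_le_mul_of_nonneg_right (hT'.eigenvalues_antitone hN hk) (sq_nonneg _)
    · rw [← hb', h2 k hk]; simp
  have hpos : 0 < ‖v‖ ^ 2 := by have := norm_pos_iff.2 hv0; positivity
  have := h v
  refine le_of_mul_le_mul_right ?_ hpos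
  linarith

/-! ### Simple eigenvalues and their spectral projections. -/

section Spectral

variable {n : ℕ}

theorem isHermitian_of_isSymm {A : SqMat n} (h : A.IsSymm) : A.IsHermitian := by
  rw [Matrix.IsHermitian, Matrix.conjTranspose_eq_transpose_of_trivial]; exact h

theorem norm_toEuclideanLin_le (A : SqMat n) (v : EuclideanSpace ℝ (Fin n)) :
    ‖Matrix.toEuclideanLin A v‖ ≤ ‖A‖ * ‖v‖ := by
  have e : ∀ u : Fin n → ℝ, ‖Matrix.replicateCol (Fin 1) u‖ = ‖WithLp.toLp 2 u‖ :=
    Matrix.frobenius_norm_replicateCol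
  have := Matrix.frobenius_norm_mul A (Matrix.replicateCol (Fin 1) v.ofLp)
  rw [← Matrix.replicateCol_mulVec, e, e] at this
  simpa [Matrix.toLpLin_apply] using this

/-- Weyl's inequality applies with `c = ‖A - B‖`, because the Frobenius norm dominates the operator
norm. For `j` out of range both eigenvalues are the default 0. -/
theorem eigval_le_add_norm_sub {A B : SqMat n} (hA : A.IsSymm) (hB : B.IsSymm) (j : ℕ) :
    eigval A j ≤ eigval B j + ‖A - B‖ := by
  by_cases hj : 1 ≤ j ∧ j ≤ n
  · rw [eigval, eigval, dif_pos ⟨isHermitian_of_isSymm hA, hj⟩,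
      dif_pos ⟨isHermitian_of_isSymm hB, hj⟩]
    refine eigenvalues_le_add_of_inner_le _ _ _ (fun v => ?_) _
    have h1 : inner ℝ (Matrix.toEuclideanLin A v) v = inner ℝ (Matrix.toEuclideanLin B v) v +
        inner ℝ (Matrix.toEuclideanLin (A - B) v) v := by
      rw [map_sub, LinearMap.sub_apply, inner_sub_left]; ring
    rw [h1]
    have h2 := real_inner_le_norm (Matrix.toEuclideanLin (A - B) v) v
    have h3 := mul_le_mul_of_nonneg_right (norm_toEuclideanLin_le (A - B) v) (norm_nonneg v)
    linarith
  · have : ∀ C : SqMat n, eigval C j = 0 := fun C => dif_neg fun h => hj h.2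
    rw [this, this]; positivity

/-- The symmetric part of a matrix, as a continuous linear map. -/
noncomputable def symL (n : ℕ) : SqMat n →L[ℝ] SqMat n :=
  LinearMap.toContinuousLinearMap
    ((2⁻¹ : ℝ) • (LinearMap.id + (Matrix.transposeLinearEquiv (Fin n) (Fin n) ℝ ℝ).toLinearMap))

theorem symL_apply (A : SqMat n) : symL n A = (2⁻¹ : ℝ) • (A + A.transpose) := by
  simp [symL]

theorem symL_isSymm (A : SqMat n) : (symL n A).IsSymm := by
  rw [symL_apply, Matrix.IsSymm]
  simp [add_comm]

theorem symL_of_isSymm {A : SqMat n} (h : A.IsSymm) : symL n A = A := by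
  rw [symL_apply, h.eq, ← two_smul ℝ A, smul_smul]; norm_num

/-- `eigval` takes the default value 0 off the symmetric matrices. Precomposing with `symL` gives a
function on an open set, for which derivatives in the full matrix space make sense. -/
theorem continuous_eigval_symL (j : ℕ) : Continuous fun A : SqMat n => eigval (symL n A) j := by
  refine continuous_iff_continuousAt.2 fun A => ?_
  have h : Tendsto (fun B => ‖symL n B - symL n A‖) (𝓝 A) (𝓝 0) := by
    have : Continuous fun B => ‖symL n B - symL n A‖ :=
      ((symL n).continuous.sub continuous_const).norm
    simpa using this.tendsto A
  refine tendsto_iff_dist_tendsto_zero.2 (squeeze_zero (fun _ => dist_nonneg) (fun B => ?_) h)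
  rw [Real.dist_eq, abs_le]
  have h1 := eigval_le_add_norm_sub (symL_isSymm A) (symL_isSymm B) j
  have h2 := eigval_le_add_norm_sub (symL_isSymm B) (symL_isSymm A) j
  rw [norm_sub_rev] at h1
  constructor <;> linarith

theorem eigvec_spec {A : SqMat n} (hA : A.IsSymm) {j : ℕ} (h1 : 1 ≤ j) (hn : j ≤ n) :
    eigvec A j ⬝ᵥ eigvec A j = 1 ∧ A.mulVec (eigvec A j) = eigval A j • eigvec A j := by
  have h := exists_unit_eigenvector (isHermitian_of_isSymm hA) h1 hn
  rw [eigvec, dif_pos h]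
  exact h.choose_spec

/-- The rank-one projection `v vᵀ` onto the line of the chosen eigenvector. -/
noncomputable def eigproj (A : SqMat n) (j : ℕ) : SqMat n :=
  Matrix.vecMulVec (eigvec A j) (eigvec A j)

theorem frobInner_vecMulVec (u v : Fin n → ℝ) (A : SqMat n) :
    frobInner (Matrix.vecMulVec u v) A = u ⬝ᵥ A.mulVec v := by
  rw [frobInner_eq_sum]
  simp only [Matrix.vecMulVec_apply, dotProduct, Matrix.mulVec, Finset.mul_sum]
  exact Finset.sum_congr rfl fun i _ => Finset.sum_congr rfl fun j _ => by ring

attribute [local instance] frobeniusInnerProductSpace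

/-- A slope formula with continuous slope gives a derivative. -/
theorem hasFDerivAt_of_slope {V : Type*} [NormedAddCommGroup V] [InnerProductSpace ℝ V] {f : V → ℝ}
    {K : V → V} {L : V →L[ℝ] V} {x : V} (hK : ContinuousAt K x)
    (h : ∀ᶠ y in 𝓝 x, f y - f x = inner ℝ (K y) (L (y - x))) :
    HasFDerivAt f ((innerSL ℝ (K x)).comp L) x := by
  rw [hasFDerivAt_iff_isLittleO, Asymptotics.isLittleO_iff]
  intro c hc
  set c' := c / (‖L‖ + 1) with hc'
  have hc'0 : 0 < c' := by positivity
  filter_upwards [h, Metric.continuousAt_iff'.1 hK c' hc'0] with y hy hKy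
  rw [hy]
  simp only [ContinuousLinearMap.comp_apply, innerSL_apply_apply]
  rw [← inner_sub_left]
  rw [dist_eq_norm] at hKy
  calc _ ≤ ‖K y - K x‖ * ‖L (y - x)‖ := norm_inner_le_norm _ _
    _ ≤ c' * ((‖L‖ + 1) * ‖y - x‖) := by
      gcongr
      exact (L.le_opNorm _).trans (by gcongr; linarith)
    _ = c * ‖y - x‖ := by rw [hc']; field_simp

/-- Near a symmetric matrix with a simple `j`-th eigenvalue, the spectral projection is continuously
differentiable, and the eigenvalue has the spectral projection as its gradient. -/
theorem eigval_differentiable_of_simple {A₀ : SqMat n} (hs : A₀.IsSymm) {j : ℕ} (h1 : 1 ≤ j)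
    (hn : j ≤ n) (hsimple : IsSimpleEigval A₀ j) :
    ContDiffAt ℝ 1 (fun A => eigproj (symL n A) j) A₀ ∧
      ∀ᶠ A in 𝓝 A₀, HasFDerivAt (fun A => eigval (symL n A) j)
        ((innerSL ℝ (eigproj (symL n A) j)).comp (symL n)) A := by
  set v₀ := eigvec A₀ j with hv₀
  obtain ⟨hv1, hv2⟩ := eigvec_spec hs h1 hn
  rw [← hv₀] at hv1 hv2
  set V₀ : SqMat n := Matrix.vecMulVec v₀ v₀ with hV₀
  set ev : SqMat n → ℝ := fun A => eigval (symL n A) j with hev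
  have hevc : Continuous ev := continuous_eigval_symL j
  -- Adding `v₀ v₀ᵀ` removes the one-dimensional kernel of `λ - A₀`. Simplicity makes `N A₀`
  -- invertible, and invertibility persists nearby since eigenvalues are continuous.
  let N : SqMat n → SqMat n := fun A => ev A • (1 : SqMat n) - symL n A + V₀
  have hNc : Continuous N :=
    ((hevc.smul continuous_const).sub (symL n).continuous).add continuous_const
  have hNs : ∀ A, (N A).transpose = N A := by
    intro A
    have : V₀.transpose = V₀ := by rw [hV₀, Matrix.transpose_vecMulVec]
    simp only [N, Matrix.transpose_add, Matrix.transpose_sub, Matrix.transpose_smul,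
      Matrix.transpose_one, this, (symL_isSymm A).eq]
  have hVmul : ∀ u, V₀.mulVec u = (v₀ ⬝ᵥ u) • v₀ := by
    intro u
    rw [hV₀, Matrix.vecMulVec_mulVec]
    simp
  have hN₀ : IsUnit (N A₀) := by
    refine isUnit_of_mulVec_injective fun u hu => ?_
    have hNu : (N A₀).mulVec u = eigval A₀ j • u - A₀.mulVec u + (v₀ ⬝ᵥ u) • v₀ := by
      simp only [N, hev, symL_of_isSymm hs, Matrix.add_mulVec, Matrix.sub_mulVec, hVmul,
        Matrix.smul_mulVec, Matrix.one_mulVec]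
    rw [hNu] at hu
    have hd : v₀ ⬝ᵥ A₀.mulVec u = eigval A₀ j * (v₀ ⬝ᵥ u) := by
      rw [Matrix.dotProduct_mulVec, ← Matrix.mulVec_transpose, hs.eq, hv2, smul_dotProduct,
        smul_eq_mul]
    have h0 : v₀ ⬝ᵥ u = 0 := by
      have := congrArg (fun w => v₀ ⬝ᵥ w) hu
      simpa [dotProduct_add, dotProduct_sub, dotProduct_smul, hd, hv1] using this
    rw [h0, zero_smul, add_zero, sub_eq_zero] at hu
    have hmem : ∀ w, A₀.mulVec w = eigval A₀ j • w →
        w ∈ Module.End.eigenspace (Matrix.toLin' A₀) (eigval A₀ j) := fun w hw =>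
      Module.End.mem_eigenspace_iff.2 (by rw [Matrix.toLin'_apply, hw])
    have hv₀0 : (⟨v₀, hmem v₀ hv2⟩ :
        Module.End.eigenspace (Matrix.toLin' A₀) (eigval A₀ j)) ≠ 0 := by
      intro h
      have : v₀ = 0 := congrArg Subtype.val h
      rw [this] at hv1; simp at hv1
    obtain ⟨a, ha⟩ := (finrank_eq_one_iff_of_nonzero' _ hv₀0).1 hsimple ⟨u, hmem u hu.symm⟩
    have ha' : a • v₀ = u := congrArg Subtype.val ha
    rw [← ha', dotProduct_smul, hv1, smul_eq_mul, mul_one] at h0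
    rw [← ha', h0, zero_smul]
  let O : Set (SqMat n) := {A | IsUnit (N A)}
  have hO : IsOpen O := by
    refine isOpen_iff_mem_nhds.2 fun A hA => hNc.continuousAt.eventually (eventually_isUnit_matrix hA)
  let J : SqMat n → SqMat n → SqMat n := fun A B => (N A)⁻¹ * V₀ * (N B)⁻¹
  -- An eigenvector `v` of `A` satisfies `N v = (v₀ ⬝ᵥ v) v₀`, so it is proportional to `N⁻¹ v₀`.
  -- The arbitrary choice in `eigvec` only affects the scalar, and normalizing by the trace
  -- eliminates it.
  have hvec : ∀ A ∈ O, ∃ c : ℝ, eigvec (symL n A) j = c • (N A)⁻¹.mulVec v₀ := by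
    intro A hA
    refine ⟨v₀ ⬝ᵥ eigvec (symL n A) j, ?_⟩
    have hv := (eigvec_spec (symL_isSymm A) h1 hn).2
    have hdet : IsUnit (N A).det := (Matrix.isUnit_iff_isUnit_det _).1 hA
    have : (N A).mulVec (eigvec (symL n A) j) = (v₀ ⬝ᵥ eigvec (symL n A) j) • v₀ := by
      simp only [N, Matrix.add_mulVec, Matrix.sub_mulVec, hVmul, Matrix.smul_mulVec,
        Matrix.one_mulVec, hv, hev, sub_self, zero_add]
    rw [← Matrix.mulVec_smul, ← this, Matrix.mulVec_mulVec, Matrix.nonsing_inv_mul _ hdet,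
      Matrix.one_mulVec]
  have hout : ∀ A B (c d : ℝ), Matrix.vecMulVec (c • (N A)⁻¹.mulVec v₀) (d • (N B)⁻¹.mulVec v₀)
      = (c * d) • J A B := by
    intro A B c d
    simp only [J, hV₀]
    rw [Matrix.mul_vecMulVec, Matrix.vecMulVec_mul, ← Matrix.mulVec_transpose,
      Matrix.transpose_nonsing_inv, hNs, Matrix.smul_vecMulVec, Matrix.vecMulVec_smul, smul_smul]
  have hprojO : ∀ A ∈ O, (J A A).trace ≠ 0 ∧
      eigproj (symL n A) j = (J A A).trace⁻¹ • J A A := by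
    intro A hA
    obtain ⟨c, hc⟩ := hvec A hA
    have hp : eigproj (symL n A) j = (c * c) • J A A := by rw [eigproj, hc, hout]
    have ht : c * c * (J A A).trace = 1 := by
      rw [← smul_eq_mul, ← Matrix.trace_smul, ← hp, eigproj, Matrix.trace_vecMulVec]
      exact (eigvec_spec (symL_isSymm A) h1 hn).1
    have ht0 : (J A A).trace ≠ 0 := right_ne_zero_of_mul_eq_one ht
    exact ⟨ht0, by rw [hp, eq_inv_of_mul_eq_one_left ht]⟩
  have hJc : ∀ A ∈ O, ∀ B ∈ O, ContinuousAt (J A) B := by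
    intro A _ B hB
    have hi : ContinuousAt (fun B => (N B)⁻¹) B :=
      (contDiffAt_matrix_inv (m := 0) hB).continuousAt.comp hNc.continuousAt
    exact ((LinearMap.mulLeft ℝ ((N A)⁻¹ * V₀)).continuous_of_finiteDimensional.continuousAt).comp hi
  have htrc : Continuous fun A : SqMat n => A.trace :=
    (Matrix.traceLinearMap (Fin n) ℝ ℝ).continuous_of_finiteDimensional
  have hderiv : ∀ A ∈ O, HasFDerivAt ev ((innerSL ℝ (eigproj (symL n A) j)).comp (symL n)) A := by
    intro A hA
    rw [(hprojO A hA).2]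
    have htr : ContinuousAt (fun B => (J A B).trace) A :=
      htrc.continuousAt.comp (hJc A hA A hA)
    refine hasFDerivAt_of_slope (K := fun B => (J A B).trace⁻¹ • J A B)
      ((htr.inv₀ (hprojO A hA).1).smul (hJc A hA A hA)) ?_
    filter_upwards [hO.mem_nhds hA, htr.eventually_ne (hprojO A hA).1] with B hB hne
    obtain ⟨c, hc⟩ := hvec A hA
    obtain ⟨d, hd⟩ := hvec B hB
    obtain ⟨hA1, hA2⟩ := eigvec_spec (symL_isSymm A) h1 hn
    obtain ⟨hB1, hB2⟩ := eigvec_spec (symL_isSymm B) h1 hn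
    have hc0 : c ≠ 0 := by rintro rfl; rw [hc] at hA1; simp at hA1
    have hd0 : d ≠ 0 := by rintro rfl; rw [hd] at hB1; simp at hB1
    -- For eigenvectors `a` of `A` and `b` of `B`, symmetry gives the exact identity `aᵀ(B - A)b =
    -- (λ(B) - λ(A)) aᵀb`. Dividing by the trace yields a slope that is continuous in `B`.
    have hkey : frobInner (Matrix.vecMulVec (eigvec (symL n A) j) (eigvec (symL n B) j))
        (symL n (B - A)) = (ev B - ev A) *
          (Matrix.vecMulVec (eigvec (symL n A) j) (eigvec (symL n B) j)).trace := by
      rw [frobInner_vecMulVec, map_sub, Matrix.sub_mulVec, dotProduct_sub, hB2, Matrix.trace_vecMulVec,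
        Matrix.dotProduct_mulVec _ (symL n A), ← Matrix.mulVec_transpose, (symL_isSymm A).eq, hA2,
        dotProduct_smul, smul_dotProduct, smul_eq_mul, smul_eq_mul]
      ring
    rw [hc, hd, hout, Matrix.trace_smul, smul_eq_mul] at hkey
    have hkey' : c * d * frobInner (J A B) (symL n (B - A))
        = c * d * ((ev B - ev A) * (J A B).trace) := by
      have e : frobInner ((c * d) • J A B) (symL n (B - A))
          = c * d * frobInner (J A B) (symL n (B - A)) := real_inner_smul_left (J A B) _ _
      rw [← e, hkey]; ring
    have hfin := mul_left_cancel₀ (mul_ne_zero hc0 hd0) hkey'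
    rw [real_inner_smul_left]
    change _ = _ * frobInner (J A B) (symL n (B - A))
    rw [hfin]; field_simp
  -- Regularity is bootstrapped: a continuous eigenvalue gives a continuous projection, which is its
  -- gradient. The eigenvalue is then C¹, hence so are `N` and the projection.
  have hev1 : ContDiffAt ℝ 1 ev A₀ := by
    rw [contDiffAt_one_iff]
    refine ⟨fun A => (innerSL ℝ ((J A A).trace⁻¹ • J A A)).comp (symL n), O, hO.mem_nhds hN₀, ?_, ?_⟩
    · intro A hA
      have hi : ContinuousAt (fun B => (N B)⁻¹) A :=
        (contDiffAt_matrix_inv (m := 0) hA).continuousAt.comp hNc.continuousAt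
      have hJ : ContinuousAt (fun B => J B B) A := by
        have : ContinuousAt (fun B : SqMat n => B * V₀ * B) (N A)⁻¹ :=
          (contDiffAt_matrix_mul (m := 0) (contDiffAt_matrix_mul contDiffAt_id contDiffAt_const)
            contDiffAt_id).continuousAt
        exact this.comp (f := fun B => (N B)⁻¹) hi
      have hK : ContinuousAt (fun B => (J B B).trace⁻¹ • J B B) A :=
        ((htrc.continuousAt.comp hJ).inv₀ (hprojO A hA).1).smul hJ
      have h2 : ContinuousAt (fun B => innerSL ℝ ((J B B).trace⁻¹ • J B B)) A :=
        (innerSL ℝ).continuous.continuousAt.comp hK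
      exact (h2.clm_comp continuousAt_const).continuousWithinAt
    · intro A hA
      have := hderiv A hA
      rw [(hprojO A hA).2] at this
      exact this
  refine ⟨?_, ?_⟩
  · have hN1 : ContDiffAt ℝ 1 N A₀ :=
      ((hev1.smul contDiffAt_const).sub (symL n).contDiff.contDiffAt).add contDiffAt_const
    have hi : ContDiffAt ℝ 1 (fun B => (N B)⁻¹) A₀ := (contDiffAt_matrix_inv hN₀).comp A₀ hN1
    have hJ : ContDiffAt ℝ 1 (fun B => J B B) A₀ :=
      contDiffAt_matrix_mul (contDiffAt_matrix_mul hi contDiffAt_const) hi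
    have ht : ContDiffAt ℝ 1 (fun B => (J B B).trace) A₀ :=
      (contDiff_linearMap (Matrix.traceLinearMap (Fin n) ℝ ℝ)).contDiffAt.comp A₀ hJ
    refine ((ht.inv (hprojO A₀ hN₀).1).smul hJ).congr_of_eventuallyEq ?_
    filter_upwards [hO.mem_nhds hN₀] with A hA
    exact (hprojO A hA).2
  · filter_upwards [hO.mem_nhds hN₀] with A hA
    exact hderiv A hA

end Spectral

/-! ### The Laplacian adjoint and the geometry of the low-rank manifold. -/

section Structure

attribute [local instance] frobeniusInnerProductSpace

variable {n : ℕ}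

theorem inner_eq_frobInner (A B : SqMat n) : inner ℝ A B = frobInner A B := rfl

/-- The Laplacian as a continuous linear map. -/
noncomputable def laplacianL (n : ℕ) : SqMat n →L[ℝ] SqMat n :=
  LinearMap.toContinuousLinearMap
    { toFun := laplacian
      map_add' := fun A B => by
        have : Matrix.diagonal (A.mulVec 1 + B.mulVec 1)
            = Matrix.diagonal (A.mulVec 1) + Matrix.diagonal (B.mulVec 1) :=
          (Matrix.diagonal_add _ _).symm
        simp only [laplacian, Matrix.add_mulVec, this]
        abel
      map_smul' := fun c A => by
        simp only [laplacian, Matrix.smul_mulVec, Matrix.diagonal_smul, smul_sub, RingHom.id_apply] }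

theorem laplacianL_apply (A : SqMat n) : laplacianL n A = laplacian A := rfl

theorem laplacian_isSymm {A : SqMat n} (h : A.IsSymm) : (laplacian A).IsSymm := by
  rw [Matrix.IsSymm, laplacian, Matrix.transpose_sub, Matrix.diagonal_transpose, h.eq]

/-- The adjoint of the Laplacian on symmetric matrices. -/
noncomputable def laplacianAdjoint (n : ℕ) : SqMat n →ₗ[ℝ] SqMat n where
  toFun A := (2⁻¹ : ℝ) • (Matrix.vecMulVec A.diag 1 + Matrix.vecMulVec 1 A.diag) - A
  map_add' A B := by
    ext i j
    simp
    ring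
  map_smul' c A := by
    ext i j
    simp
    ring

/-- The diagonal part of `L` has adjoint `A ↦ diag(A) 𝟙ᵀ`. Testing against symmetric `Z` allows this
to be replaced by its symmetric part. -/
theorem frobInner_laplacianAdjoint (A : SqMat n) {Z : SqMat n} (hZ : Z.IsSymm) :
    frobInner (laplacianAdjoint n A) Z = frobInner A (laplacian Z) := by
  have h1 : ∑ i, ∑ j, A j j * Z i j = ∑ i, ∑ j, A i i * Z i j := by
    rw [Finset.sum_comm]
    exact Finset.sum_congr rfl fun i _ => Finset.sum_congr rfl fun j _ => by rw [hZ.apply]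
  have h2 : ∑ i, ∑ j, A i j * (laplacian Z) i j
      = ∑ i, ∑ j, A i i * Z i j - ∑ i, ∑ j, A i j * Z i j := by
    simp only [laplacian, Matrix.sub_apply, mul_sub, Finset.sum_sub_distrib]
    congr 1
    refine Finset.sum_congr rfl fun i _ => ?_
    simp [Matrix.diagonal_apply, Matrix.mulVec, dotProduct, Finset.mul_sum]
  rw [frobInner_eq_sum, frobInner_eq_sum, h2]
  have h3 : ∑ i, ∑ j, (laplacianAdjoint n A) i j * Z i j
      = 2⁻¹ * (∑ i, ∑ j, A i i * Z i j + ∑ i, ∑ j, A j j * Z i j) - ∑ i, ∑ j, A i j * Z i j := by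
    simp only [← Finset.sum_add_distrib, Finset.mul_sum, ← Finset.sum_sub_distrib]
    refine Finset.sum_congr rfl fun i _ => Finset.sum_congr rfl fun j _ => ?_
    simp [laplacianAdjoint]
    ring
  rw [h3, h1]
  ring

/-- Every symmetric matrix of the right rank whose tangential part is a nonzero multiple of `Y` is
itself that multiple of `Y`. -/
theorem eq_smul_of_tangentProj_eq {Y A : SqMat n} {μ : ℝ} (hY : Y.IsSymm) (hA : A.IsSymm)
    (hr : A.rank ≤ Y.rank) (hμ : μ ≠ 0) (h : tangentProj Y A = μ • Y) : A = μ • Y := by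
  set P := rangeProj Y with hP
  have hPs : P.transpose = P := rangeProj_transpose Y
  have hPP : P * P = P := rangeProj_mul_rangeProj Y
  have hPY : P * Y = Y := rangeProj_mul_self Y
  have hYP : Y * P = Y := mul_rangeProj_of_isSymm hY
  -- Multiplying by `P` kills the normal part. As `μ ≠ 0`, this gives `ker A ≤ ker Y`, and the rank
  -- bound turns it into equality.
  have hPA : P * A = μ • Y := by
    have := congrArg (P * ·) h
    simp only [tangentProj, hY.eq, ← hP] at this
    rw [mul_sub, Matrix.mul_assoc (1 - P), ← Matrix.mul_assoc P (1 - P), mul_sub, mul_one, hPP,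
      sub_self, zero_mul, sub_zero, Matrix.mul_smul, hPY] at this
    exact this
  have hker : LinearMap.ker A.mulVecLin ≤ LinearMap.ker Y.mulVecLin := by
    intro v hv
    rw [LinearMap.mem_ker, Matrix.mulVecLin_apply] at hv ⊢
    have := congrArg P.mulVec hv
    rw [Matrix.mulVec_mulVec, hPA, Matrix.mulVec_zero, Matrix.smul_mulVec] at this
    exact (smul_eq_zero.1 this).resolve_left hμ
  have heq : LinearMap.ker A.mulVecLin = LinearMap.ker Y.mulVecLin := by
    refine Submodule.eq_of_le_of_finrank_le hker ?_
    have h1 := LinearMap.finrank_range_add_finrank_ker A.mulVecLin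
    have h2 := LinearMap.finrank_range_add_finrank_ker Y.mulVecLin
    have h3 : Module.finrank ℝ (LinearMap.range A.mulVecLin)
      ≤ Module.finrank ℝ (LinearMap.range Y.mulVecLin) := hr
    omega
  have hAQ : A * (1 - P) = 0 := by
    ext i j
    have hm : (1 - P).mulVec (Pi.single j 1) ∈ LinearMap.ker Y.mulVecLin := by
      rw [LinearMap.mem_ker, Matrix.mulVecLin_apply, Matrix.mulVec_mulVec, mul_sub, mul_one, hYP,
        sub_self, Matrix.zero_mulVec]
    rw [← heq, LinearMap.mem_ker, Matrix.mulVecLin_apply, Matrix.mulVec_mulVec,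
      Matrix.mulVec_single_one] at hm
    exact congrFun hm i
  have hAP : A * P = A := by
    rw [mul_sub, mul_one, sub_eq_zero] at hAQ
    exact hAQ.symm
  have := congrArg Matrix.transpose hAP
  rw [Matrix.transpose_mul, hPs, hA.eq, hPA] at this
  exact this.symm

/-- Locally, the range projection is bounded and Lipschitz on symmetric matrices of rank `≤ r`. -/
theorem exists_lipschitz_rangeProj {r : ℕ} {Y₀ : SqMat n} (hs : Y₀.IsSymm) (hr : Y₀.rank = r) :
    ∃ K : ℝ, 0 ≤ K ∧ ∃ u ∈ 𝓝 Y₀, (∀ Y ∈ u, Y.IsSymm → Y.rank ≤ r → ‖1 - rangeProj Y‖ ≤ K) ∧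
      ∀ Y ∈ u, ∀ Z ∈ u, Y.IsSymm → Y.rank ≤ r → Z.IsSymm → Z.rank ≤ r →
        ‖rangeProj Y - rangeProj Z‖ ≤ K * ‖Y - Z‖ := by
  obtain ⟨X, hX, hev⟩ := exists_contDiffAt_rangeProj hs hr
  have hPc : ContDiffAt ℝ 1 (fun Y => Y * X Y) Y₀ := contDiffAt_matrix_mul contDiffAt_id hX
  obtain ⟨K, u, hu, hL⟩ := hPc.exists_lipschitzOnWith
  have hb : ∀ᶠ Y in 𝓝 Y₀, ‖1 - Y * X Y‖ < ‖1 - Y₀ * X Y₀‖ + 1 :=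
    (continuousAt_const.sub hPc.continuousAt).norm.eventually (Iio_mem_nhds (lt_add_one _))
  refine ⟨max K (‖1 - Y₀ * X Y₀‖ + 1), le_max_of_le_left K.2, _,
    inter_mem hu (inter_mem hev hb), ?_, ?_⟩
  · rintro Y ⟨_, h1, h2⟩ hYs hYr
    rw [← h1 hYs hYr]
    exact le_max_of_le_right h2.le
  · rintro Y ⟨hYu, hY1, _⟩ Z ⟨hZu, hZ1, _⟩ hYs hYr hZs hZr
    rw [← hY1 hYs hYr, ← hZ1 hZs hZr]
    refine (hL.norm_sub_le hYu hZu).trans ?_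
    gcongr
    exact le_max_left _ _

/-- Low-rank matrices close to a multiple of `Y` are tangential at `Y` up to second order. -/
theorem exists_normal_part_le {r : ℕ} {Y₀ : SqMat n} (hs : Y₀.IsSymm) (hr : Y₀.rank = r) {μ : ℝ}
    (hμ : μ ≠ 0) :
    ∃ K : ℝ, 0 ≤ K ∧ ∃ u ∈ 𝓝 Y₀, ∃ w ∈ 𝓝 (μ • Y₀), ∀ Y ∈ u, Y.IsSymm → Y.rank ≤ r →
      ∀ A ∈ w, A.IsSymm → A.rank ≤ r → ‖A - tangentProj Y A‖ ≤ K * ‖A - μ • Y‖ ^ 2 := by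
  obtain ⟨K, hK, u, hu, hb, hL⟩ := exists_lipschitz_rangeProj hs hr
  have hcont : Tendsto (fun A : SqMat n => μ⁻¹ • A) (𝓝 (μ • Y₀)) (𝓝 Y₀) := by
    have : ContinuousAt (fun A : SqMat n => μ⁻¹ • A) (μ • Y₀) := (continuous_const_smul μ⁻¹).continuousAt
    simpa [ContinuousAt, smul_smul, inv_mul_cancel₀ hμ] using this
  have hnb : ∀ᶠ A in 𝓝 (μ • Y₀), ‖A‖ < ‖μ • Y₀‖ + 1 :=
    continuous_norm.continuousAt.eventually (Iio_mem_nhds (lt_add_one _))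
  refine ⟨K * (K * |μ|⁻¹) * (‖μ • Y₀‖ + 1) * (K * (K * |μ|⁻¹)), by positivity, u, hu, _,
    inter_mem (hcont hu) hnb, ?_⟩
  rintro Y hYu hYs hYr A ⟨hAu, hAn⟩ hAs hAr
  -- Rescaling leaves the range unchanged and brings `A` near `Y₀`, where the Lipschitz bound for
  -- the range projection applies.
  set B := μ⁻¹ • A with hB
  have hAB : A = μ • B := by rw [hB, smul_smul, mul_inv_cancel₀ hμ, one_smul]
  have hBs : B.IsSymm := hAs.smul _
  have hBr : B.rank ≤ r := by
    have : B = (μ⁻¹ • (1 : SqMat n)) * A := by rw [smul_mul_assoc, one_mul]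
    rw [this]
    exact (Matrix.rank_mul_le_right _ _).trans hAr
  set P := rangeProj Y with hP
  set Q := rangeProj B with hQ
  have hPP : P * P = P := rangeProj_mul_rangeProj Y
  have hQA : Q * A = A := by rw [hAB, mul_smul_comm, hQ, rangeProj_mul_self]
  have hAQ : A * Q = A := by rw [hAB, smul_mul_assoc, hQ, mul_rangeProj_of_isSymm hBs]
  have e1 : (1 - P) * A = (1 - P) * (Q - P) * A := by
    have : (1 - P) * P = 0 := by rw [sub_mul, one_mul, hPP, sub_self]
    rw [mul_sub, this, sub_zero, Matrix.mul_assoc, hQA]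
  have e2 : A * (1 - P) = A * ((Q - P) * (1 - P)) := by
    have : P * (1 - P) = 0 := by rw [mul_sub, mul_one, hPP, sub_self]
    rw [sub_mul, this, sub_zero, ← Matrix.mul_assoc, hAQ]
  -- Each side of the normal part contributes a factor `Q - P`, because `A = Q A Q` and `(1 - P) P =
  -- 0`. This is the source of the quadratic bound.
  have e3 : A - tangentProj Y A = (1 - P) * (Q - P) * A * ((Q - P) * (1 - P)) := by
    rw [tangentProj, hYs.eq, sub_sub_cancel, ← hP, e1, Matrix.mul_assoc, e2, ← Matrix.mul_assoc]
  have h1P : ‖1 - P‖ ≤ K := hb Y hYu hYs hYr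
  have hQP : ‖Q - P‖ ≤ K * |μ|⁻¹ * ‖A - μ • Y‖ := by
    refine (hL B hAu Y hYu hBs hBr hYs hYr).trans_eq ?_
    have : A - μ • Y = μ • (B - Y) := by rw [smul_sub, ← hAB]
    rw [this, norm_smul, Real.norm_eq_abs]
    field_simp
  rw [e3]
  calc _ ≤ ‖1 - P‖ * ‖Q - P‖ * ‖A‖ * (‖Q - P‖ * ‖1 - P‖) := by
        refine (Matrix.frobenius_norm_mul _ _).trans ?_
        gcongr
        · refine (Matrix.frobenius_norm_mul _ _).trans ?_
          gcongr
          exact Matrix.frobenius_norm_mul _ _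
        · exact Matrix.frobenius_norm_mul _ _
    _ ≤ K * (K * |μ|⁻¹ * ‖A - μ • Y‖) * (‖μ • Y₀‖ + 1) * ((K * |μ|⁻¹ * ‖A - μ • Y‖) * K) := by
        gcongr
        exact hAn.le
    _ = _ := by ring

/-! ### The gradient of the gap and the form of the low-rank field. -/

namespace WeightedGraph

variable (G : WeightedGraph n) (k : ℕ) (ε : ℝ)

/-- Only the spectral projections enter, so the signs of the chosen eigenvectors are irrelevant. The
adjoint of the Laplacian identifies `R` as a gradient via the chain rule. -/
theorem R_eq (E : SqMat n) :
    G.R k ε E = laplacianAdjoint n (eigproj (G.lap ε E) (k + 1) - eigproj (G.lap ε E) k) := by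
  ext i j
  simp only [R, laplacianAdjoint, eigproj]
  simp [Matrix.vecMulVec_apply]
  ring

theorem R_isSymm (E : SqMat n) : (G.R k ε E).IsSymm := by
  rw [Matrix.IsSymm, R]
  simp [Matrix.transpose_vecMulVec, add_comm]

/-- Four rank-one summands: this is why rank 4 is the natural rank for the flow. -/
theorem rank_R_le (E : SqMat n) : (G.R k ε E).rank ≤ 4 := by
  have h1 : ∀ u v : Fin n → ℝ, (Matrix.vecMulVec u v : SqMat n).rank ≤ 1 :=
    fun u v => Matrix.rank_vecMulVec_le u v
  simp only [R]
  set x := eigvec (G.lap ε E) (k + 1)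
  set y := eigvec (G.lap ε E) k
  set z := x * x - y * y
  have e : (2⁻¹ : ℝ) • (Matrix.vecMulVec z 1 + Matrix.vecMulVec 1 z) - Matrix.vecMulVec x x
      + Matrix.vecMulVec y y = Matrix.vecMulVec ((2⁻¹ : ℝ) • z) 1
        + Matrix.vecMulVec ((2⁻¹ : ℝ) • 1) z + Matrix.vecMulVec (-x) x + Matrix.vecMulVec y y := by
    rw [Matrix.smul_vecMulVec, Matrix.smul_vecMulVec, Matrix.neg_vecMulVec, smul_add, sub_eq_add_neg]
  rw [e]
  refine (matrix_rank_add_le _ _).trans (Nat.add_le_add (b := 3) ?_ (h1 _ _))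
  refine (matrix_rank_add_le _ _).trans (Nat.add_le_add (b := 2) ?_ (h1 _ _))
  exact (matrix_rank_add_le _ _).trans (Nat.add_le_add (b := 1) (h1 _ _) (h1 _ _))

theorem lap_isSymm {E : SqMat n} (h : E.IsSymm) : (G.lap ε E).IsSymm :=
  laplacian_isSymm (G.weight_symm.add (h.smul ε))

theorem lap_eq (E : SqMat n) : G.lap ε E = laplacianL n G.weight + ε • laplacianL n E := by
  rw [lap, ← laplacianL_apply, map_add, map_smul]

/-- Near a symmetric matrix with simple `λ_k`, `λ_{k+1}`, the matrix `R_ε` is continuously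
differentiable and `ε R_ε` is the gradient of the gap functional. -/
theorem gap_differentiable_of_simple {E₀ : SqMat n} (hE : E₀.IsSymm) (hk : 1 ≤ k) (hkn : k + 1 ≤ n)
    (h1 : IsSimpleEigval (G.lap ε E₀) k) (h2 : IsSimpleEigval (G.lap ε E₀) (k + 1)) :
    ContDiffAt ℝ 1 (fun E => G.R k ε (symL n E)) E₀ ∧
      ∃ F' : SqMat n → SqMat n →L[ℝ] ℝ,
        (∀ᶠ E in 𝓝 E₀, HasFDerivAt (fun E => G.gap k ε (symL n E)) (F' E) E) ∧
        ∀ E D, D.IsSymm → F' E D = ε * inner ℝ (G.R k ε (symL n E)) D := by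
  let Λ : SqMat n → SqMat n := fun E => G.lap ε (symL n E)
  let Λ' : SqMat n →L[ℝ] SqMat n := ε • (laplacianL n).comp (symL n)
  have hΛ : ∀ E, HasFDerivAt Λ Λ' E := by
    intro E
    have e : Λ = fun E => laplacianL n G.weight + Λ' E := funext fun E => G.lap_eq ε _
    rw [e]
    exact Λ'.hasFDerivAt.const_add _
  have hΛc : ContDiff ℝ 1 Λ := by
    have e : Λ = fun E => laplacianL n G.weight + Λ' E := funext fun E => G.lap_eq ε _
    rw [e]
    exact contDiff_const.add Λ'.contDiff
  have hΛs : ∀ E, (Λ E).IsSymm := fun E => G.lap_isSymm ε (symL_isSymm E)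
  have hΛ0 : Λ E₀ = G.lap ε E₀ := by simp only [Λ, symL_of_isSymm hE]
  have hk1 := eigval_differentiable_of_simple (hΛs E₀) (j := k) hk (by omega) (by rwa [hΛ0])
  have hk2 := eigval_differentiable_of_simple (hΛs E₀) (j := k + 1) (by omega) hkn (by rwa [hΛ0])
  have hproj : ∀ j E, eigproj (symL n (Λ E)) j = eigproj (G.lap ε (symL n E)) j := fun j E => by
    rw [symL_of_isSymm (hΛs E)]
  refine ⟨?_, fun E => ((innerSL ℝ (eigproj (symL n (Λ E)) (k + 1))).comp (symL n)).comp Λ' -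
      ((innerSL ℝ (eigproj (symL n (Λ E)) k)).comp (symL n)).comp Λ', ?_, ?_⟩
  · have h3 : ContDiffAt ℝ 1 (fun E => eigproj (symL n (Λ E)) (k + 1) - eigproj (symL n (Λ E)) k) E₀ :=
      (hk2.1.comp E₀ hΛc.contDiffAt).sub (hk1.1.comp E₀ hΛc.contDiffAt)
    have h4 := (contDiff_linearMap (m := 1) (laplacianAdjoint n)).contDiffAt.comp E₀ h3
    refine h4.congr_of_eventuallyEq (Eventually.of_forall fun E => ?_)
    simp only [Function.comp_apply, hproj, R_eq]
  · filter_upwards [(hΛ E₀).continuousAt.eventually hk1.2, (hΛ E₀).continuousAt.eventually hk2.2]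
      with E hE1 hE2
    have h5 := (hE2.comp E (hΛ E)).sub (hE1.comp E (hΛ E))
    refine h5.congr_of_eventuallyEq (Eventually.of_forall fun E => ?_)
    simp only [Function.comp_apply, symL_of_isSymm (hΛs E), gap, Λ, Pi.sub_apply]
  · intro E D hD
    have h6 : symL n (Λ' D) = ε • laplacian D := by
      have : Λ' D = ε • laplacian D := by
        simp only [Λ', _root_.smul_apply, ContinuousLinearMap.comp_apply,
          symL_of_isSymm hD, laplacianL_apply]
      rw [this, symL_of_isSymm ((laplacian_isSymm hD).smul ε)]
    change inner ℝ (eigproj (symL n (Λ E)) (k + 1)) (symL n (Λ' D))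
      - inner ℝ (eigproj (symL n (Λ E)) k) (symL n (Λ' D)) = _
    rw [h6, hproj, hproj, ← inner_sub_left, real_inner_smul_right, R_eq, inner_eq_frobInner, inner_eq_frobInner,
      frobInner_laplacianAdjoint _ hD]

/-- The projection onto the sparsity pattern as a continuous linear map. -/
noncomputable def patL : SqMat n →L[ℝ] SqMat n :=
  LinearMap.toContinuousLinearMap
    { toFun := G.patProj
      map_add' := fun A B => by
        ext i j
        simp only [patProj, Matrix.of_apply, Matrix.add_apply]
        split_ifs <;> simp
      map_smul' := fun c A => by
        ext i j
        simp only [patProj, Matrix.of_apply, Matrix.smul_apply, RingHom.id_apply]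
        split_ifs <;> simp }

theorem patL_apply (A : SqMat n) : G.patL A = G.patProj A := rfl

theorem patProj_isSymm {A : SqMat n} (h : A.IsSymm) : (G.patProj A).IsSymm := by
  refine Matrix.IsSymm.ext fun i j => ?_
  have : (j, i) ∈ G.edges ↔ (i, j) ∈ G.edges := ⟨G.edges_symm j i, G.edges_symm i j⟩
  simp only [patProj, Matrix.of_apply, h.apply i j]
  split_ifs <;> simp_all

/-- The symmetric matrices with the sparsity pattern of the graph. -/
noncomputable def symPattern : Submodule ℝ (SqMat n) where
  carrier := {E | E.IsSymm ∧ ∀ i j, (i, j) ∉ G.edges → E i j = 0}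
  add_mem' := fun {A B} hA hB => ⟨hA.1.add hB.1, fun i j h => by simp [hA.2 i j h, hB.2 i j h]⟩
  zero_mem' := ⟨Matrix.isSymm_zero, fun _ _ _ => rfl⟩
  smul_mem' := fun c A hA => ⟨hA.1.smul c, fun i j h => by simp [hA.2 i j h]⟩

theorem patProj_mem_symPattern {A : SqMat n} (h : A.IsSymm) : G.patProj A ∈ G.symPattern :=
  ⟨G.patProj_isSymm h, fun i j hij => by simp [patProj, hij]⟩

theorem inner_patProj_left (A B : SqMat n) :
    inner ℝ (G.patProj A) B = inner ℝ A (G.patProj B) := by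
  rw [inner_eq_frobInner, inner_eq_frobInner, frobInner_eq_sum, frobInner_eq_sum]
  refine Finset.sum_congr rfl fun i _ => Finset.sum_congr rfl fun j _ => ?_
  simp only [patProj, Matrix.of_apply]
  split_ifs <;> simp

theorem patProj_of_mem {A : SqMat n} (h : A ∈ G.symPattern) : G.patProj A = A := by
  ext i j
  simp only [patProj, Matrix.of_apply]
  split_ifs with hij
  · rfl
  · exact (h.2 i j hij).symm

theorem patProj_patProj (A : SqMat n) : G.patProj (G.patProj A) = G.patProj A := by
  ext i j
  simp only [patProj, Matrix.of_apply]
  split_ifs <;> rfl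

theorem norm_patProj_le (A : SqMat n) : ‖G.patProj A‖ ≤ ‖A‖ := by
  have h : ‖G.patProj A‖ ^ 2 ≤ ‖G.patProj A‖ * ‖A‖ := by
    rw [← real_inner_self_eq_norm_sq, G.inner_patProj_left, G.patProj_patProj, mul_comm]
    exact real_inner_le_norm _ _
  rcases (norm_nonneg (G.patProj A)).eq_or_lt with h0 | h0
  · rw [← h0]; exact norm_nonneg _
  · rw [sq] at h; exact le_of_mul_le_mul_left h h0

/-- The low-rank vector field extends to a continuously differentiable field of the form
`Y ↦ C(Y) Y + Y C(Y)ᵀ` near a symmetric matrix of rank `4`. -/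
theorem exists_contDiffAt_lowRankField {Y₀ : SqMat n} (hY : Y₀ ∈ symRankFour n)
    (hR : ContDiffAt ℝ 1 (fun E => G.R k ε (symL n E)) (G.patProj Y₀)) :
    ∃ C : SqMat n → SqMat n, ContDiffAt ℝ 1 C Y₀ ∧ ∀ᶠ Y in 𝓝 Y₀, Y ∈ symRankFour n →
      G.lowRankField k ε Y = C Y * Y + Y * (C Y).transpose := by
  obtain ⟨X, hX, hev⟩ := exists_contDiffAt_rangeProj hY.2 hY.1
  let P : SqMat n → SqMat n := fun Y => Y * X Y
  let S : SqMat n → SqMat n := fun Y => G.R k ε (symL n (G.patL Y))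
  let T : SqMat n → SqMat n := fun Y => S Y - (1 - P Y) * S Y * (1 - P Y)
  have hP : ContDiffAt ℝ 1 P Y₀ := contDiffAt_matrix_mul contDiffAt_id hX
  have hPL : ContDiffAt ℝ 1 G.patL Y₀ := G.patL.contDiff.contDiffAt
  have hS : ContDiffAt ℝ 1 S Y₀ := ContDiffAt.comp (f := G.patL) Y₀ hR hPL
  have h1P : ContDiffAt ℝ 1 (fun Y => 1 - P Y) Y₀ := contDiffAt_const.sub hP
  have hT : ContDiffAt ℝ 1 T Y₀ :=
    hS.sub (contDiffAt_matrix_mul (contDiffAt_matrix_mul h1P hS) h1P)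
  have hXt : ContDiffAt ℝ 1 (fun Y => (X Y).transpose) Y₀ :=
    (contDiff_linearMap (Matrix.transposeLinearEquiv (Fin n) (Fin n) ℝ ℝ).toLinearMap).contDiffAt.comp
      Y₀ hX
  -- On symmetric rank-4 `Y` one has `P = Y X = XᵀY`, so the tangential part `SP + PS - PSP`
  -- acquires a factor `Y` on one side of each term. The scalar term and `PSP` are split evenly
  -- between the two transposed halves.
  refine ⟨fun Y => (2⁻¹ * inner ℝ (T Y) (G.patL Y) : ℝ) • (1 : SqMat n)
      - (S Y - (2⁻¹ : ℝ) • (P Y * S Y)) * (X Y).transpose, ?_, ?_⟩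
  · exact ((contDiffAt_const.mul (hT.inner ℝ hPL)).smul contDiffAt_const).sub
      (contDiffAt_matrix_mul (hS.sub ((contDiffAt_matrix_mul hP hS).const_smul (2⁻¹ : ℝ))) hXt)
  filter_upwards [hev] with Y hYev hYm
  have hPr : P Y = rangeProj Y := hYev hYm.2 hYm.1.le
  have hPs : (P Y).transpose = P Y := by rw [hPr, rangeProj_transpose]
  have hXY : (X Y).transpose * Y = P Y := by
    rw [← hPs]; simp only [P, Matrix.transpose_mul, hYm.2.eq]
  have hSE : S Y = G.R k ε (G.patProj Y) := by
    simp only [S, patL_apply, symL_of_isSymm (G.patProj_isSymm hYm.2)]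
  have hSs : (S Y).transpose = S Y := by rw [hSE]; exact G.R_isSymm k ε _
  have hTt : tangentProj Y (G.R k ε (G.patProj Y)) = T Y := by
    rw [tangentProj, hYm.2.eq, ← hPr, ← hSE]
  have e1 : ((2⁻¹ * inner ℝ (T Y) (G.patL Y) : ℝ) • (1 : SqMat n)
      - (S Y - (2⁻¹ : ℝ) • (P Y * S Y)) * (X Y).transpose) * Y
      = (2⁻¹ * inner ℝ (T Y) (G.patL Y) : ℝ) • Y - (S Y - (2⁻¹ : ℝ) • (P Y * S Y)) * P Y := by
    rw [sub_mul, smul_mul_assoc, one_mul, Matrix.mul_assoc, hXY]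
  have e2 := congrArg Matrix.transpose e1
  rw [Matrix.transpose_mul, hYm.2.eq] at e2
  simp only [lowRankField]
  rw [e1, e2, hTt]
  simp only [Matrix.transpose_sub, Matrix.transpose_smul, Matrix.transpose_mul, hPs, hSs, hYm.2.eq,
    ← inner_eq_frobInner, patL_apply, T]
  generalize P Y = P'
  generalize S Y = S'
  have e3 : ∀ a : ℝ, a • Y = (2⁻¹ * a) • Y + (2⁻¹ * a) • Y := fun a => by
    rw [← add_smul]; congr 1; ring
  rw [e3]
  have e4 : S' * P' + P' * S' - P' * S' * P' =
      (S' - (2⁻¹ : ℝ) • (P' * S')) * P' + P' * (S' - (2⁻¹ : ℝ) • (S' * P')) := by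
    have : P' * S' * P' = (2⁻¹ : ℝ) • (P' * S' * P') + (2⁻¹ : ℝ) • (P' * S' * P') := by
      rw [← add_smul]; norm_num
    rw [sub_mul, mul_sub, smul_mul_assoc, mul_smul_comm, ← Matrix.mul_assoc]
    nth_rewrite 1 [this]
    abel
  have e5 : S' - (1 - P') * S' * (1 - P') = S' * P' + P' * S' - P' * S' * P' := by noncomm_ring
  generalize (inner ℝ (S' - (1 - P') * S' * (1 - P')) (G.patProj Y) : ℝ) = a
  rw [e5, e4]
  abel

end WeightedGraph

end Structure

/-! ### Truncated flows and the Lipschitz inverse of the projection. -/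

variable {n : ℕ}

/-- A vector field `C(Y) Y + Y C(Y)ᵀ` that is smooth near `Z` can be truncated away from `Z` so that
its integral curves are complete and stay in the symmetric matrices of rank at most `r`. -/
theorem exists_truncated_flow {C : SqMat n → SqMat n} {Z : SqMat n} (hC : ContDiffAt ℝ 1 C Z)
    (r : ℕ) : ∃ ρ > 0, ∀ Y₀ : SqMat n, Y₀.IsSymm → Y₀.rank ≤ r → ∃ Y : ℝ → SqMat n, Y 0 = Y₀ ∧
      (∀ t, 0 ≤ t → (Y t).IsSymm ∧ (Y t).rank ≤ r) ∧ ContinuousOn Y (Ici 0) ∧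
      ∀ t, 0 ≤ t → ‖Y t - Z‖ < ρ →
        HasDerivWithinAt Y (C (Y t) * Y t + Y t * (C (Y t)).transpose) (Ici 0) t := by
  obtain ⟨R, hR, hball⟩ := Metric.eventually_nhds_iff_ball.1 (hC.eventually (by simp))
  let χ : ContDiffBump Z := ⟨R / 4, R / 2, by positivity, by linarith⟩
  let D : SqMat n → SqMat n := fun Y => χ Y • C Y
  let tr : SqMat n →ₗ[ℝ] SqMat n := (Matrix.transposeLinearEquiv (Fin n) (Fin n) ℝ ℝ).toLinearMap
  have hDs : HasCompactSupport D := χ.hasCompactSupport.smul_right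
  have hDc : ContDiff ℝ 1 D := by
    refine contDiff_iff_contDiffAt.2 fun Y => ?_
    by_cases hY' : Y ∈ tsupport χ
    swap
    · refine (contDiffAt_const (c := (0 : SqMat n))).congr_of_eventuallyEq ?_
      filter_upwards [notMem_tsupport_iff_eventuallyEq.1 hY'] with A hA
      have hA' : χ A = 0 := hA
      simp only [D, hA', zero_smul]
    have hYb : Y ∈ Metric.closedBall Z (R / 2) := χ.tsupport_eq.le hY'
    have : dist Y Z < R := (Metric.mem_closedBall.1 hYb).trans_lt (half_lt_self hR)
    exact χ.contDiffAt.smul (hball Y this)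
  obtain ⟨K, hK⟩ := hDs.exists_bound_of_continuous hDc.continuous
  -- With `symL n Y` in place of `Y` the field takes only symmetric values, so symmetric initial
  -- data stay symmetric. Along such solutions `symL` then disappears, leaving the form needed for
  -- rank invariance.
  let f : SqMat n → SqMat n := fun Y => D Y * symL n Y + symL n Y * (D Y).transpose
  have hfc : ContDiff ℝ 1 f := by
    have hs : ContDiff ℝ 1 (symL n) := (symL n).contDiff
    have ht : ContDiff ℝ 1 (fun Y => (D Y).transpose) := (contDiff_linearMap tr).comp hDc
    exact contDiff_iff_contDiffAt.2 fun Y =>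
      (contDiffAt_matrix_mul hDc.contDiffAt hs.contDiffAt).add
        (contDiffAt_matrix_mul hs.contDiffAt ht.contDiffAt)
  have hfs : HasCompactSupport f := by
    refine hDs.mono fun Y hY hD => hY ?_
    have hD' : D Y = 0 := hD
    simp [f, hD']
  obtain ⟨L, hL⟩ := hfc.lipschitzWith_of_hasCompactSupport hfs one_ne_zero
  obtain ⟨B, hB⟩ := hfs.exists_bound_of_continuous hfc.continuous
  refine ⟨R / 4, by positivity, fun Y₀ hs hr => ?_⟩
  obtain ⟨Y, hY0, hY⟩ := exists_global_solution hL hB Y₀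
  have hcont : ContinuousOn Y (Ici 0) := fun t ht => (hY t ht).continuousWithinAt
  have hfsymm : ∀ A, (f A).transpose = f A := by
    intro A
    simp only [f, Matrix.transpose_add, Matrix.transpose_mul, (symL_isSymm A).eq,
      Matrix.transpose_transpose]
    exact add_comm _ _
  have hsymm : ∀ t, 0 ≤ t → (Y t).IsSymm := by
    intro T hT
    let trL := LinearMap.toContinuousLinearMap tr
    have hd : ∀ t ∈ Ico 0 T, HasDerivWithinAt (fun t => trL (Y t) - Y t) 0 (Ici t) t := by
      intro t ht
      have h1 := (hY t ht.1).mono (Ici_subset_Ici.2 ht.1)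
      refine ((trL.hasFDerivAt.comp_hasDerivWithinAt t h1).sub h1).congr_deriv ?_
      exact sub_eq_zero.2 (hfsymm _)
    have hc : ContinuousOn (fun t => trL (Y t) - Y t) (Icc 0 T) :=
      ((trL.continuous.comp_continuousOn hcont).sub hcont).mono Icc_subset_Ici_self
    have := constant_of_has_deriv_right_zero hc hd T (right_mem_Icc.2 hT)
    rw [hY0] at this
    have h0 : trL Y₀ - Y₀ = 0 := sub_eq_zero.2 hs.eq
    rw [h0] at this
    exact sub_eq_zero.1 this
  have hY' : ∀ t, 0 ≤ t →
      HasDerivWithinAt Y (D (Y t) * Y t + Y t * (D (Y t)).transpose) (Ici 0) t := by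
    intro t ht
    refine (hY t ht).congr_deriv ?_
    simp only [f, symL_of_isSymm (hsymm t ht)]
  have hrank := rank_le_of_hasDerivWithinAt (r := r) (C := fun t => D (Y t)) (fun t _ => hK (Y t)) hY'
    (by rwa [hY0])
  refine ⟨Y, hY0, fun t ht => ⟨hsymm t ht, hrank t ht⟩, hcont, fun t ht hlt => ?_⟩
  refine (hY' t ht).congr_deriv ?_
  have h1 : χ (Y t) = 1 := χ.one_of_mem_closedBall (by
    rw [Metric.mem_closedBall, dist_eq_norm]; exact hlt.le)
  simp only [D, h1, one_smul]

/-- The smooth inverse extends to a neighbourhood of `f x` as a C¹, hence locally Lipschitz, map.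
Continuity of `f` keeps `f y` in that neighbourhood. -/
theorem eventually_norm_sub_le_of_isDiffeoOntoImage {V : Type*} [NormedAddCommGroup V]
    [NormedSpace ℝ V] {f : V → V} {X : Set V} (hf : IsDiffeoOntoImage f X) {x : V} (hx : x ∈ X)
    (hfc : ContinuousAt f x) :
    ∃ L : ℝ, 0 ≤ L ∧ ∀ᶠ y in 𝓝 x, y ∈ X → ‖y - x‖ ≤ L * ‖f y - f x‖ := by
  obtain ⟨-, g, hg, hinv⟩ := hf
  obtain ⟨O, h, hO, hxO, hh, hgh⟩ := hg (f x) (mem_image_of_mem f hx)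
  have hh1 : ContDiffAt ℝ 1 h (f x) := (hh.contDiffAt (hO.mem_nhds hxO)).of_le (by simp)
  obtain ⟨K, u, hu, hL⟩ := hh1.exists_lipschitzOnWith
  have key : ∀ y ∈ X, f y ∈ O → h (f y) = y := fun y hy hyO => by
    rw [hgh _ ⟨mem_image_of_mem f hy, hyO⟩, hinv hy]
  refine ⟨K, K.2, ?_⟩
  filter_upwards [hfc.eventually (hO.mem_nhds hxO), hfc.eventually hu] with y hyO hyu hy
  have := hL.norm_sub_le hyu (mem_of_mem_nhds hu)
  rwa [key y hy hyO, key x hx hxO] at this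

/-! ### Local contraction and descent estimates. -/

section Estimates

attribute [local instance] frobeniusInnerProductSpace

/-- The two one-sided estimates for the perturbed spherical gradient flow: if the spherical gradient
is monotone at `E - D` and the perturbation `Q` is small compared to `D`, then the flow contracts
towards `E - D` and decreases the functional. -/
theorem perturbed_gradient_estimates {V : Type*} [NormedAddCommGroup V] [InnerProductSpace ℝ V]
    {P : V → V} (hadj : ∀ a b, inner ℝ (P a) b = inner ℝ a (P b)) (hPP : ∀ a, P (P a) = P a)
    {E D R T : V} {c : ℝ} (hc : 0 < c) (hE : P E = E) (hD : P D = D) (hE1 : ‖E‖ = 1)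
    (hmono : c * ‖D‖ ^ 2 ≤ inner ℝ R D - inner ℝ R E * inner ℝ E D)
    (hQ : ‖R - T‖ ≤ c / 4 * ‖D‖) :
    inner ℝ (inner ℝ T E • E - P T) D ≤ -(c / 2) * ‖D‖ ^ 2 ∧
      inner ℝ R (inner ℝ T E • E - P T) ≤ 0 := by
  obtain ⟨Q, rfl⟩ : ∃ Q, T = R - Q := ⟨R - T, by rw [sub_sub_cancel]⟩
  rw [sub_sub_cancel] at hQ
  have hQE : |inner ℝ Q E| ≤ ‖Q‖ := by
    have := abs_real_inner_le_norm Q E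
    rwa [hE1, mul_one] at this
  have hED : |inner ℝ E D| ≤ ‖D‖ := by
    have := abs_real_inner_le_norm E D
    rwa [hE1, one_mul] at this
  have hQD : |inner ℝ Q D| ≤ ‖Q‖ * ‖D‖ := abs_real_inner_le_norm Q D
  have hQED : |inner ℝ Q E * inner ℝ E D| ≤ ‖Q‖ * ‖D‖ := by
    rw [abs_mul]; gcongr
  have hQ2 : ‖Q‖ * ‖D‖ ≤ c / 4 * ‖D‖ ^ 2 := by
    rw [sq, ← mul_assoc]; gcongr
  -- The perturbation `Q` enters the contraction through two terms of size at most `(c/4)‖D‖²`, so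
  -- half of the rate survives. For descent, with `g` the spherical gradient, the quantity equals
  -- `-‖g‖² + ⟨g, Q⟩`, and monotonicity gives `‖g‖ ≥ c‖D‖ ≥ ‖Q‖`.
  refine ⟨?_, ?_⟩
  · rw [inner_sub_left, real_inner_smul_left, hadj, hD, inner_sub_left, inner_sub_left]
    have h1 := (abs_le.1 hQD).2
    have h2 := (abs_le.1 hQED).1
    linarith
  · set g := P R - inner ℝ R E • E with hg
    have hgD : inner ℝ g D = inner ℝ R D - inner ℝ R E * inner ℝ E D := by
      rw [hg, inner_sub_left, real_inner_smul_left, hadj, hD]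
    have hgn : c * ‖D‖ ≤ ‖g‖ := by
      rcases (norm_nonneg D).eq_or_lt with h0 | h0
      · rw [← h0, mul_zero]; exact norm_nonneg _
      · have h1 := real_inner_le_norm g D
        rw [hgD] at h1
        refine le_of_mul_le_mul_right ?_ h0
        calc c * ‖D‖ * ‖D‖ = c * ‖D‖ ^ 2 := by ring
          _ ≤ _ := hmono.trans h1
    have hQg : ‖Q‖ ≤ ‖g‖ := by
      have : 0 ≤ c * ‖D‖ := by positivity
      linarith
    have hPRR : inner ℝ R (P R) = ‖P R‖ ^ 2 := by
      rw [← real_inner_self_eq_norm_sq, hadj, hPP]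
    have hPRE : inner ℝ (P R) E = inner ℝ R E := by rw [hadj, hE]
    have hg2 : ‖g‖ ^ 2 = ‖P R‖ ^ 2 - inner ℝ R E ^ 2 := by
      rw [hg, norm_sub_sq_real, real_inner_smul_right, hPRE, norm_smul, hE1, mul_one,
        Real.norm_eq_abs, sq_abs]
      ring
    have hgQ : inner ℝ g Q = inner ℝ R (P Q) - inner ℝ R E * inner ℝ Q E := by
      rw [hg, inner_sub_left, real_inner_smul_left, hadj, real_inner_comm E Q]
    have hPT : inner ℝ R (P (R - Q)) = ‖P R‖ ^ 2 - inner ℝ R (P Q) := by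
      rw [← hadj, inner_sub_right, hadj, hPRR, hadj]
    have h3 := real_inner_le_norm g Q
    have h4 : ‖g‖ * ‖Q‖ ≤ ‖g‖ * ‖g‖ := by gcongr
    rw [inner_sub_right, real_inner_smul_right, hPT, inner_sub_left]
    nlinarith

namespace WeightedGraph

variable (G : WeightedGraph n) (k : ℕ) (ε : ℝ)

theorem lowRankField_isSymm {Y : SqMat n} (hY : Y.IsSymm) : (G.lowRankField k ε Y).IsSymm := by
  have hR := G.R_isSymm k ε (G.patProj Y)
  have : (tangentProj Y (G.R k ε (G.patProj Y))).IsSymm := by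
    rw [tangentProj, hY.eq, Matrix.IsSymm]
    simp only [Matrix.transpose_sub, Matrix.transpose_mul, rangeProj_transpose, hR.eq,
      Matrix.transpose_one, Matrix.mul_assoc]
  exact (hY.smul _).sub this

theorem patProj_lowRankField (Y : SqMat n) : G.patProj (G.lowRankField k ε Y) =
    inner ℝ (tangentProj Y (G.R k ε (G.patProj Y))) (G.patProj Y) • G.patProj Y
      - G.patProj (tangentProj Y (G.R k ε (G.patProj Y))) := by
  simp only [← patL_apply, lowRankField, map_sub, map_smul]
  rfl

/-- At a stationary point the gradient is a multiple of the stationary point. -/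
theorem exists_R_eq_smul {Y : SqMat n} (hY : Y ∈ symRankFour n) (hstat : G.lowRankField k ε Y = 0)
    (hPR : tangentProj Y (G.R k ε (G.patProj Y)) ≠ 0) :
    ∃ μ : ℝ, μ ≠ 0 ∧ G.R k ε (G.patProj Y) = μ • Y := by
  have h : tangentProj Y (G.R k ε (G.patProj Y)) =
      frobInner (tangentProj Y (G.R k ε (G.patProj Y))) (G.patProj Y) • Y :=
    (sub_eq_zero.1 hstat).symm
  have hμ : frobInner (tangentProj Y (G.R k ε (G.patProj Y))) (G.patProj Y) ≠ 0 := by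
    intro h0
    rw [h0, zero_smul] at h
    exact hPR h
  refine ⟨_, hμ, eq_smul_of_tangentProj_eq hY.2 (G.R_isSymm k ε _) ?_ hμ h⟩
  rw [hY.1]
  exact G.rank_R_le k ε _

/-- Local estimates for the low-rank vector field near a stationary point lying over a strong local
minimum of the gap functional. -/
theorem lowRankField_estimates {Z : SqMat n} {μ α r L : ℝ} (hε : 0 < ε) (hZ : Z ∈ symRankFour n)
    (hnorm : ‖G.patProj Z‖ = 1)
    (hRdiff : ContDiffAt ℝ 1 (fun E => G.R k ε (symL n E)) (G.patProj Z))
    {F' : SqMat n → SqMat n →L[ℝ] ℝ}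
    (hF : ∀ᶠ E in 𝓝 (G.patProj Z), HasFDerivAt (fun E => G.gap k ε (symL n E)) (F' E) E)
    (hF' : ∀ E D, D.IsSymm → F' E D = ε * inner ℝ (G.R k ε (symL n E)) D)
    (hμ : μ ≠ 0) (hRZ : G.R k ε (G.patProj Z) = μ • Z) (hα : 0 < α) (hr : 0 < r)
    (hmin : ∀ E ∈ G.unitSphere, ‖E - G.patProj Z‖ < r →
      G.gap k ε (G.patProj Z) + α * ‖E - G.patProj Z‖ ^ 2 ≤ G.gap k ε E)
    (hdiff : ∀ᶠ Y in 𝓝 Z, Y ∈ symRankFour n →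
      ‖Y - Z‖ ≤ L * ‖G.patProj Y - G.patProj Z‖) :
    ∃ c > 0, ∃ K : ℝ, ∀ᶠ Y in 𝓝 Z, Y ∈ symRankFour n →
      |inner ℝ (G.patProj (G.lowRankField k ε Y)) (G.patProj Y)|
        ≤ K * |‖G.patProj Y‖ ^ 2 - 1| ∧
      (‖G.patProj Y‖ = 1 →
        inner ℝ (G.patProj (G.lowRankField k ε Y)) (G.patProj Y - G.patProj Z)
          ≤ -c * ‖G.patProj Y - G.patProj Z‖ ^ 2 ∧
        inner ℝ (G.R k ε (G.patProj Y)) (G.patProj (G.lowRankField k ε Y)) ≤ 0) := by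
  set e := G.patProj Z with he
  have heS : e ∈ G.symPattern := G.patProj_mem_symPattern hZ.2
  have hpc : ContinuousAt G.patProj Z := G.patL.continuous.continuousAt
  obtain ⟨R', hR'⟩ := hRdiff.differentiableAt one_ne_zero
  have hmono := eventually_gradient_monotone_of_quadratic_growth G.symPattern (μ := μ) hε hα hr heS
    hnorm hF (fun E D hD => hF' E D hD.1) hR'
    -- Criticality of `e`: since `R(e) = μ Z`, testing with `d` in the pattern sees only `μ Π_S Z =
    -- μ e`.
    (by
      intro d hd
      rw [symL_of_isSymm heS.1, hRZ, real_inner_smul_left, he, G.inner_patProj_left,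
        G.patProj_of_mem hd])
    (by
      intro x hx hx1 hxr
      rw [symL_of_isSymm heS.1, symL_of_isSymm hx.1]
      exact hmin x ⟨hx.1, hx.2, hx1⟩ hxr)
  obtain ⟨K₁, u₁, hu₁, hLip⟩ := hRdiff.exists_lipschitzOnWith
  obtain ⟨K₂, hK₂, u, hu, w, hw, hnormal⟩ := exists_normal_part_le hZ.2 hZ.1 hμ
  set c := α / ε with hc
  have hc0 : 0 < c := by positivity
  set K₃ : ℝ := K₂ * (K₁ + |μ|) ^ 2 with hK₃
  have hK₃0 : 0 ≤ K₃ := by positivity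
  have hRc : ContinuousAt (fun Y => G.R k ε (symL n (G.patProj Y))) Z :=
    ContinuousAt.comp (f := G.patProj) hRdiff.continuousAt hpc
  have hRw : ∀ᶠ Y in 𝓝 Z, G.R k ε (symL n (G.patProj Y)) ∈ w := by
    refine hRc.eventually ?_
    change ∀ᶠ A in 𝓝 (G.R k ε (symL n e)), A ∈ w
    rw [symL_of_isSymm heS.1, hRZ]
    exact hw
  -- Writing the normal part as `K₃‖Y - Z‖ · ‖Y - Z‖` and applying the bound `hdiff` to one factor
  -- makes it at most `(c/4)‖E - e‖`.
  have hsmall : ∀ᶠ Y in 𝓝 Z, K₃ * L * ‖Y - Z‖ < c / 4 := by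
    have h1 : ContinuousAt (fun Y => K₃ * L * ‖Y - Z‖) Z := by fun_prop
    refine h1.eventually (Iio_mem_nhds ?_)
    simpa using hc0
  have hRb : ∀ᶠ Y in 𝓝 Z, ‖G.R k ε (symL n (G.patProj Y))‖ < ‖G.R k ε (symL n e)‖ + 1 :=
    hRc.norm.eventually (Iio_mem_nhds (lt_add_one _))
  have hEb : ∀ᶠ Y in 𝓝 Z, ‖G.patProj Y‖ < ‖e‖ + 1 :=
    hpc.norm.eventually (Iio_mem_nhds (lt_add_one _))
  have hYb : ∀ᶠ Y in 𝓝 Z, ‖Y - Z‖ < 1 := by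
    filter_upwards [Metric.ball_mem_nhds Z one_pos] with Y hY
    rwa [Metric.mem_ball, dist_eq_norm] at hY
  refine ⟨c / 2, by positivity, (‖G.R k ε (symL n e)‖ + 1 + K₃) * (‖e‖ + 1), ?_⟩
  filter_upwards [hpc.eventually hmono, hpc.eventually hu₁, hu, hRw, hsmall, hRb, hEb, hYb, hdiff]
    with Y hmonoY hu₁Y huY hRwY hsmallY hRbY hEbY hYbY hdiffY hY
  have hES : G.patProj Y ∈ G.symPattern := G.patProj_mem_symPattern hY.2
  rw [symL_of_isSymm hES.1] at hRwY hRbY hmonoY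
  set E := G.patProj Y with hE
  set R := G.R k ε E with hRdef
  set T := tangentProj Y R with hT
  have hPE : G.patProj E = E := G.patProj_of_mem hES
  have hRY : ‖R - μ • Y‖ ≤ (K₁ + |μ|) * ‖Y - Z‖ := by
    have h1 := hLip.norm_sub_le hu₁Y (mem_of_mem_nhds hu₁)
    simp only [symL_of_isSymm hES.1, symL_of_isSymm heS.1] at h1
    rw [hRZ] at h1
    have h2 : ‖E - e‖ ≤ ‖Y - Z‖ := by
      have h3 := G.norm_patProj_le (Y - Z)
      rw [← patL_apply, map_sub] at h3
      exact h3
    have h4 : R - μ • Y = (R - μ • Z) - μ • (Y - Z) := by rw [smul_sub]; abel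
    rw [h4]
    refine (norm_sub_le _ _).trans ?_
    rw [norm_smul, Real.norm_eq_abs, add_mul]
    gcongr
    exact h1.trans (by gcongr)
  have hQ : ‖R - T‖ ≤ K₃ * ‖Y - Z‖ ^ 2 := by
    refine (hnormal Y huY hY.2 hY.1.le R hRwY (G.R_isSymm k ε E) (G.rank_R_le k ε E)).trans ?_
    rw [hK₃, mul_assoc, ← mul_pow]
    gcongr
  have hfield := G.patProj_lowRankField k ε Y
  rw [← hE, ← hRdef, ← hT] at hfield
  rw [hfield]
  refine ⟨?_, fun hE1 => ?_⟩
  -- The radial component of the projected field carries the factor `‖E‖² - 1`, so the sphere is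
  -- invariant.
  · have h1 : inner ℝ (inner ℝ T E • E - G.patProj T) E = inner ℝ T E * (‖E‖ ^ 2 - 1) := by
      rw [inner_sub_left, real_inner_smul_left, G.inner_patProj_left T E, hPE, real_inner_self_eq_norm_sq]
      ring
    rw [h1, abs_mul]
    refine mul_le_mul_of_nonneg_right ((abs_real_inner_le_norm T E).trans ?_) (abs_nonneg _)
    have h2 : ‖T‖ ≤ ‖G.R k ε (symL n e)‖ + 1 + K₃ := by
      have h3 : T = R - (R - T) := by rw [sub_sub_cancel]
      rw [h3]
      refine (norm_sub_le _ _).trans (add_le_add hRbY.le (hQ.trans ?_))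
      exact mul_le_of_le_one_right hK₃0 (pow_le_one₀ (norm_nonneg _) hYbY.le)
    gcongr
  · refine perturbed_gradient_estimates G.inner_patProj_left G.patProj_patProj hc0 hPE
      (G.patProj_of_mem (G.symPattern.sub_mem hES heS)) hE1 (hmonoY hES hE1) (hQ.trans ?_)
    calc K₃ * ‖Y - Z‖ ^ 2 = K₃ * ‖Y - Z‖ * ‖Y - Z‖ := by ring
      _ ≤ K₃ * ‖Y - Z‖ * (L * ‖E - e‖) := by gcongr; exact hdiffY hY
      _ = K₃ * L * ‖Y - Z‖ * ‖E - e‖ := by ring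
      _ ≤ c / 4 * ‖E - e‖ := by gcongr

end WeightedGraph

end Estimates

/-! ### Existence and exponential convergence. -/

section Convergence

attribute [local instance] frobeniusInnerProductSpace

namespace WeightedGraph

variable {n : ℕ} (G : WeightedGraph n) (k : ℕ) (ε : ℝ)

/-- Exponential convergence of the low-rank flow near a stationary point at which the sparsity
projection is a local embedding. -/
theorem lowRank_flow_converges (hk : 1 ≤ k) (hkn : k + 1 ≤ n) (hε : 0 < ε)
    {Z : SqMat n} (hZ : Z ∈ symRankFour n) (hnorm : ‖G.patProj Z‖ = 1)
    (h1 : IsSimpleEigval (G.lap ε (G.patProj Z)) k)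
    (h2 : IsSimpleEigval (G.lap ε (G.patProj Z)) (k + 1))
    (hstat : G.lowRankField k ε Z = 0)
    (hPR : tangentProj Z (G.R k ε (G.patProj Z)) ≠ 0)
    (hmin : IsStrongLocalMinOn (G.gap k ε) G.unitSphere (G.patProj Z)) {L : ℝ} (hL : 0 ≤ L)
    (hdiff : ∀ᶠ Y in 𝓝 Z, Y ∈ symRankFour n → ‖Y - Z‖ ≤ L * ‖G.patProj Y - G.patProj Z‖) :
    ∃ δ > 0, ∃ C > 0, ∃ c > 0, ∀ Y₀ ∈ symRankFour n, ‖G.patProj Y₀‖ = 1 → ‖Y₀ - Z‖ < δ →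
      (∃ Y : ℝ → SqMat n, G.IsLowRankSolution k ε Y ∧ Y 0 = Y₀) ∧
      ∀ Y : ℝ → SqMat n, G.IsLowRankSolution k ε Y → Y 0 = Y₀ →
        (∀ t, 0 ≤ t → ‖Y t - Z‖ ≤ C * Real.exp (-c * t)) ∧
        AntitoneOn (fun t => G.gap k ε (G.patProj (Y t))) (Ici 0) ∧
        (∀ t, 0 ≤ t →
          |G.gap k ε (G.patProj (Y t)) - G.gap k ε (G.patProj Z)| ≤ C * Real.exp (-c * t)) := by
  have heS := G.patProj_isSymm hZ.2
  obtain ⟨hRdiff, F', hF, hF'⟩ := G.gap_differentiable_of_simple k ε heS hk hkn h1 h2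
  obtain ⟨μ, hμ, hRZ⟩ := G.exists_R_eq_smul k ε hZ hstat hPR
  obtain ⟨-, α, hα, r, hr, hgrow⟩ := hmin
  obtain ⟨c, hc, K, hest⟩ := G.lowRankField_estimates k ε hε hZ hnorm hRdiff hF hF' hμ hRZ hα hr
    hgrow hdiff
  obtain ⟨C, hC, hfield⟩ := G.exists_contDiffAt_lowRankField k ε hZ hRdiff
  obtain ⟨ρ₀, hρ₀, hflow⟩ := exists_truncated_flow hC 4
  have hpc : ContinuousAt G.patProj Z := G.patL.continuous.continuousAt
  obtain ⟨B, hB⟩ := (hF.self_of_nhds.isBigO_sub).bound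
  have hrank : ∀ᶠ Y in 𝓝 Z, ¬ Y.rank ≤ 3 :=
    (isClosed_rank_le 3).isOpen_compl.mem_nhds (by
      change ¬ Z.rank ≤ 3
      rw [hZ.1]; norm_num)
  obtain ⟨ρ, hρ, H⟩ := Metric.eventually_nhds_iff_ball.1
    (hest.and (hfield.and (hdiff.and (hrank.and ((hpc.eventually hF).and (hpc.eventually hB))))))
  set ρ₁ := min ρ ρ₀ with hρ₁
  have hρ₁0 : 0 < ρ₁ := lt_min hρ hρ₀
  have H' : ∀ Y, ‖Y - Z‖ < ρ₁ → _ := fun Y hY =>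
    H Y (by rw [mem_ball_iff_norm]; exact hY.trans_le (min_le_left _ _))
  have hPsub : ∀ A B : SqMat n, ‖G.patProj A - G.patProj B‖ ≤ ‖A - B‖ := fun A B => by
    have := G.norm_patProj_le (A - B)
    rw [← patL_apply, map_sub] at this
    exact this
  -- Both `‖Y 0 - Z‖` and `L‖Π_S Y(0) - Π_S Z‖` must be below `ρ₁`.
  set δ := min ρ₁ (ρ₁ / (L + 1)) with hδ
  have hδ0 : 0 < δ := lt_min hρ₁0 (by positivity)
  -- The field and rank conditions are required only inside the ball, so this covers both the
  -- truncated flow and arbitrary solutions.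
  have main : ∀ Y : ℝ → SqMat n, ContinuousOn Y (Ici 0) →
      (∀ t, 0 ≤ t → ‖Y t - Z‖ < ρ₁ →
        Y t ∈ symRankFour n ∧ HasDerivWithinAt Y (G.lowRankField k ε (Y t)) (Ici 0) t) →
      ‖G.patProj (Y 0)‖ = 1 → ‖Y 0 - Z‖ < δ →
      ∀ t, 0 ≤ t → ‖Y t - Z‖ < ρ₁ ∧ ‖G.patProj (Y t)‖ = 1 ∧
        ‖G.patProj (Y t) - G.patProj Z‖ ≤ ρ₁ * Real.exp (-c * t) := by
    intro Y hYc hYd hY0 hYδ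
    have h0 : ‖G.patProj (Y 0) - G.patProj Z‖ < δ := (hPsub _ _).trans_lt hYδ
    have h0L : L * ‖G.patProj (Y 0) - G.patProj Z‖ < ρ₁ := by
      have h3 : δ * (L + 1) ≤ ρ₁ := by
        rw [← le_div_iff₀ (by positivity)]; exact min_le_right _ _
      nlinarith [norm_nonneg (G.patProj (Y 0) - G.patProj Z)]
    have hfl := flow_estimate (P := G.patL) (A := symRankFour n) (v := G.lowRankField k ε) (y := Z)
      (ρ := ρ₁) hL hc
      (fun x hx hxρ => ((H' x hxρ).1 hx).1)
      (fun x hx hxρ _ => (H' x hxρ).2.2.1 hx)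
      (fun x hx hxρ hx1 => (((H' x hxρ).1 hx).2 hx1).1)
      hYc hYd hY0 (hYδ.trans_le (min_le_left _ _)) h0L
    intro t ht
    obtain ⟨ha, hb, hcc⟩ := hfl t ht
    refine ⟨ha, hb, hcc.trans ?_⟩
    exact mul_le_mul_of_nonneg_right (h0.le.trans (min_le_left _ _)) (Real.exp_pos _).le
  -- `L ρ₁` bounds the distance to `Z`, `|B| ρ₁` bounds the gap difference, and the 1 ensures
  -- positivity.
  refine ⟨δ, hδ0, (L + |B| + 1) * ρ₁, by positivity, c, hc, fun Y₀ hY₀ hY₀n hY₀δ => ⟨?_, ?_⟩⟩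
  · obtain ⟨Y, hY0, hYs, hYc, hYd⟩ := hflow Y₀ hY₀.2 hY₀.1.le
    -- Inside the ball the rank exceeds 3, while the truncated flow keeps it at most 4. There the
    -- truncated field also coincides with the true one.
    have hmem : ∀ t, 0 ≤ t → ‖Y t - Z‖ < ρ₁ →
        Y t ∈ symRankFour n ∧ HasDerivWithinAt Y (G.lowRankField k ε (Y t)) (Ici 0) t := by
      intro t ht hlt
      have hr4 : Y t ∈ symRankFour n := by
        refine ⟨?_, (hYs t ht).1⟩
        have := (H' (Y t) hlt).2.2.2.1
        have := (hYs t ht).2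
        omega
      refine ⟨hr4, ?_⟩
      rw [(H' (Y t) hlt).2.1 hr4]
      exact hYd t ht (hlt.trans_le (min_le_right _ _))
    have hmain := main Y hYc hmem (by rwa [hY0]) (by rwa [hY0])
    exact ⟨Y, fun t ht => hmem t ht (hmain t ht).1, hY0⟩
  · intro Y hY hY0
    have hYc : ContinuousOn Y (Ici 0) := fun t ht => (hY t ht).2.continuousWithinAt
    have hmain := main Y hYc (fun t ht _ => hY t ht) (by rwa [hY0]) (by rwa [hY0])
    have hgap : ∀ t, 0 ≤ t → G.gap k ε (symL n (G.patProj (Y t))) = G.gap k ε (G.patProj (Y t)) :=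
      fun t ht => by rw [symL_of_isSymm (G.patProj_isSymm (hY t ht).1.2)]
    refine ⟨fun t ht => ?_, ?_, fun t ht => ?_⟩
    · obtain ⟨ha, -, hb⟩ := hmain t ht
      refine ((H' (Y t) ha).2.2.1 (hY t ht).1).trans ?_
      calc L * ‖G.patProj (Y t) - G.patProj Z‖ ≤ L * (ρ₁ * Real.exp (-c * t)) := by gcongr
        _ = L * ρ₁ * Real.exp (-c * t) := by ring
        _ ≤ _ := by
          gcongr
          linarith [abs_nonneg B]
    · have hder : ∀ t, 0 ≤ t → HasDerivWithinAt (fun t => G.gap k ε (symL n (G.patProj (Y t))))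
          (ε * inner ℝ (G.R k ε (G.patProj (Y t))) (G.patProj (G.lowRankField k ε (Y t))))
          (Ici 0) t := by
        intro t ht
        have h3 := (H' (Y t) (hmain t ht).1).2.2.2.2.1
        have h4 : HasDerivWithinAt (fun t => G.patL (Y t)) (G.patL (G.lowRankField k ε (Y t)))
            (Ici 0) t := G.patL.hasFDerivAt.comp_hasDerivWithinAt t (hY t ht).2
        have h5 := HasFDerivAt.comp_hasDerivWithinAt (f := fun t => G.patL (Y t)) t h3 h4
        refine h5.congr_deriv ?_
        refine (hF' _ _ (G.patProj_isSymm (G.lowRankField_isSymm k ε (hY t ht).1.2))).trans ?_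
        rw [symL_of_isSymm (G.patProj_isSymm (hY t ht).1.2)]
      have hanti := antitoneOn_of_hasDerivWithinAt_nonpos (convex_Ici (0 : ℝ))
        (fun t ht => (hder t ht).continuousWithinAt)
        (fun t ht => (hder t (interior_subset ht)).mono interior_subset) (fun t ht => by
          have ht' : 0 ≤ t := interior_subset ht
          have := (((H' (Y t) (hmain t ht').1).1 (hY t ht').1).2 (hmain t ht').2.1).2
          exact mul_nonpos_of_nonneg_of_nonpos hε.le this)
      exact hanti.congr fun t ht => hgap t ht
    · obtain ⟨ha, -, hb⟩ := hmain t ht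
      have h6 := (H' (Y t) ha).2.2.2.2.2
      rw [hgap t ht, symL_of_isSymm heS, Real.norm_eq_abs] at h6
      refine h6.trans ?_
      calc B * ‖G.patProj (Y t) - G.patProj Z‖ ≤ |B| * (ρ₁ * Real.exp (-c * t)) := by
            gcongr
            exact le_abs_self B
        _ = |B| * ρ₁ * Real.exp (-c * t) := by ring
        _ ≤ _ := by
          gcongr
          linarith

end WeightedGraph

end Convergence

end LowRankFlow

theorem mainTheorem2 {n : ℕ} (G : LowRankFlow.WeightedGraph n)
    (k : ℕ) (hk : 2 ≤ k) (hkn : k + 1 ≤ n) (ε : ℝ) (hε : 0 < ε)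
    (Ystar : Matrix (Fin n) (Fin n) ℝ) (hY : Ystar ∈ LowRankFlow.symRankFour n)
    (hnorm : ‖G.patProj Ystar‖ = 1)
    (hsimple_k : LowRankFlow.IsSimpleEigval (G.lap ε (G.patProj Ystar)) k)
    (hsimple_k1 : LowRankFlow.IsSimpleEigval (G.lap ε (G.patProj Ystar)) (k + 1))
    (hstat : G.lowRankField k ε Ystar = 0)
    (hPR : LowRankFlow.tangentProj Ystar (G.R k ε (G.patProj Ystar)) ≠ 0)
    (hmin : LowRankFlow.IsStrongLocalMinOn (G.gap k ε) G.unitSphere (G.patProj Ystar))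
    (U : Set (Matrix (Fin n) (Fin n) ℝ)) (hU : IsOpen U) (hYU : Ystar ∈ U)
    (hdiffeo : LowRankFlow.IsDiffeoOntoImage G.patProj
      ({Y : Matrix (Fin n) (Fin n) ℝ | Y.rank = 4} ∩ U)) :
    ∃ δ > 0, ∃ C > 0, ∃ c > 0, ∀ Y₀ ∈ LowRankFlow.symRankFour n,
      ‖G.patProj Y₀‖ = 1 → ‖Y₀ - Ystar‖ < δ →
      (∃ Y : ℝ → Matrix (Fin n) (Fin n) ℝ, G.IsLowRankSolution k ε Y ∧ Y 0 = Y₀) ∧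
      ∀ Y : ℝ → Matrix (Fin n) (Fin n) ℝ, G.IsLowRankSolution k ε Y → Y 0 = Y₀ →
        (∀ t, 0 ≤ t → ‖Y t - Ystar‖ ≤ C * Real.exp (-c * t)) ∧
        AntitoneOn (fun t => G.gap k ε (G.patProj (Y t))) (Set.Ici 0) ∧
        (∀ t, 0 ≤ t →
          |G.gap k ε (G.patProj (Y t)) - G.gap k ε (G.patProj Ystar)| ≤ C * Real.exp (-c * t)) := by
  -- The diffeomorphism enters only through this linear bound at `Ystar`.
  obtain ⟨L, hL, hev⟩ := LowRankFlow.eventually_norm_sub_le_of_isDiffeoOntoImage hdiffeo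
    ⟨hY.1, hYU⟩ G.patL.continuous.continuousAt
  refine G.lowRank_flow_converges k ε (by omega) hkn hε hY hnorm hsimple_k hsimple_k1 hstat hPR hmin
    hL ?_
  filter_upwards [hev, hU.mem_nhds hYU] with Y hYev hYU' hYm
  exact hYev ⟨hYm.1, hYU'⟩
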